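/- Let $n\ge 3$ and $m\ge 3$ be integers and let $M$ be a compact $n$-dimensional manifold with boundary, of class $C^{m+1}$ (so that $C^m$ Riemannian metrics make sense). Let $\mathscr M^m$ be the set of all $C^m$ Riemannian metrics on $M$, with the topology given by the $C^m$ norm: for a finite open covering $\{V_\lambda\}$ of $M$ such that the closure of each $V_\lambda$ lies in the domain of a chart $\psi_\lambda$, $$\|k\|_m=\sum_\lambda\sum_{|\alpha|\le m}\sum_{i,j=1}^n\ \sup_{\psi_\lambda(V_\lambda)}|\partial^\alpha k_{ij}|$$ (all such choices give the same topology). For $g\in\mathscr M^m$ let $\mathbb I_g=(h_{ij})$ be the second fundamental form of $\partial M$, let $H_g=g^{ij}h_{ij}$ be the boundary mean curvature, and let $\|\mathbb I_g\|^2=g^{ik}g^{j\ell}h_{ij}h_{k\ell}$ (indices tangent to $\partial M$). Put $\mathscr E^m=\{g\in\mathscr M^m:\ \mathbb I_g(p)\ne 0\ \text{for all } p\in\partial M\}$. Then the set $$\mathcal A=\{g\in\mathscr E^m:\ H_g\equiv 0\ \text{on } \partial M,\ \text{and all critical points of the function } \|\mathbb I_g\|^2:\partial M\to\mathbb R \text{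 are non-degenerate}\}$$ is an open and dense subset of $\{g\in\mathscr E^m:\ H_g\equiv 0\ \text{on } \partial M\}$, with the subspace topology. -/

import Mathlib

open Set Manifold
open scoped ContDiff ENNReal

noncomputable section

namespace BoundaryMorse

/-- `C^m` Riemannian metrics on a manifold with boundary `M` of dimension `n`. -/
abbrev Metric (n : ℕ) [NeZero n] (m : ℕ) (M : Type*) [TopologicalSpace M]
    [ChartedSpace (EuclideanHalfSpace n) M] [IsManifold (𝓡∂ n) 1 M] :=
  Bundle.ContMDiffRiemannianMetric (𝓡∂ n) (m : ℕ∞ω) (EuclideanSpace ℝ (Fin n))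
    (fun p : M => TangentSpace (𝓡∂ n) p)

section Charts

variable {n : ℕ} [NeZero n] {M : Type*} [TopologicalSpace M]
  [ChartedSpace (EuclideanHalfSpace n) M]

/-- A covariant 2-tensor field on `M` (with no regularity imposed). -/
abbrev TensorField (n : ℕ) [NeZero n] (M : Type*) [TopologicalSpace M]
    [ChartedSpace (EuclideanHalfSpace n) M] :=
  ∀ p : M, TangentSpace (𝓡∂ n) p →L[ℝ] TangentSpace (𝓡∂ n) p →L[ℝ] ℝ

/-- The coordinate vector field `∂_i` of the chart `e`, at the point with coordinates `x`. -/
def coordVec (e : OpenPartialHomeomorph M (EuclideanHalfSpace n)) (x : EuclideanSpace ℝ (Fin n))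
    (i : Fin n) : TangentSpace (𝓡∂ n) ((e.extend (𝓡∂ n)).symm x) :=
  mfderivWithin 𝓘(ℝ, EuclideanSpace ℝ (Fin n)) (𝓡∂ n) (e.extend (𝓡∂ n)).symm
    (range (𝓡∂ n)) x (EuclideanSpace.single i (1 : ℝ))

/-- The components `k_{ij} = k(∂_i, ∂_j)` in the chart `e`, as functions of the coordinates. -/
def comp (k : TensorField n M) (e : OpenPartialHomeomorph M (EuclideanHalfSpace n))
    (i j : Fin n) (x : EuclideanSpace ℝ (Fin n)) : ℝ :=
  k ((e.extend (𝓡∂ n)).symm x) (coordVec e x i) (coordVec e x j)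

/-! ### The second fundamental form of the boundary

Half-space charts are used: the boundary is `{x_0 = 0}`, the interior is `{x_0 > 0}`, and
the indices `i ≠ 0` are the ones tangent to the boundary. At a point `p` everything is computed
in the preferred chart at `p`. -/

/-- The indices of the coordinates tangent to the boundary. -/
abbrev TIdx (n : ℕ) [NeZero n] := {i : Fin n // i ≠ 0}

/-- The matrix `(g_{ij})` of a tensor at `p`. -/
def gram (k : TensorField n M) (p : M) : Matrix (Fin n) (Fin n) ℝ :=
  Matrix.of fun i j => comp k (chartAt (EuclideanHalfSpace n) p) i j (extChartAt (𝓡∂ n) p p)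

/-- The matrix of the metric induced on the boundary, at a boundary point `p`. -/
def bdryGram (k : TensorField n M) (p : M) : Matrix (TIdx n) (TIdx n) ℝ :=
  (gram k p).submatrix Subtype.val Subtype.val

/-- `∂_c k_{ij}` at `p`. -/
def dComp (k : TensorField n M) (p : M) (c i j : Fin n) : ℝ :=
  fderivWithin ℝ (comp k (chartAt (EuclideanHalfSpace n) p) i j) (range (𝓡∂ n))
    (extChartAt (𝓡∂ n) p p) (EuclideanSpace.single c (1 : ℝ))

/-- Christoffel symbols of the first kind of the Levi-Civita connection,
`Γ_{ij,d} = g(∇_{∂_i} ∂_j, ∂_d)`, at `p`. -/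
def christoffel (k : TensorField n M) (p : M) (i j d : Fin n) : ℝ :=
  (dComp k p i j d + dComp k p j i d - dComp k p d i j) / 2

/-- The components `ν^d` of the inward unit normal `grad x_0 / |grad x_0|` to the boundary. -/
def normal (k : TensorField n M) (p : M) (d : Fin n) : ℝ :=
  (gram k p)⁻¹ d 0 / Real.sqrt ((gram k p)⁻¹ 0 0)

/-- The second fundamental form `h_{ij} = g(∇_{∂_i} ∂_j, ν)` of the boundary, at a boundary
point `p`; in Fermi coordinates `h_{ij} = -∂_t g_{ij} / 2`. -/
def sff (k : TensorField n M) (p : M) : Matrix (TIdx n) (TIdx n) ℝ :=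
  Matrix.of fun i j => ∑ d, christoffel k p i j d * normal k p d

/-- The boundary mean curvature `g^{ij} h_{ij}`. -/
def meanCurv (k : TensorField n M) (p : M) : ℝ :=
  ∑ i, ∑ j, (bdryGram k p)⁻¹ i j * sff k p i j

/-- The squared norm `g^{ik} g^{jl} h_{ij} h_{kl}` of the second fundamental form. -/
def sffNormSq (g : TensorField n M) (p : M) : ℝ :=
  ∑ i, ∑ j, ∑ k, ∑ l,
    (bdryGram g p)⁻¹ i k * (bdryGram g p)⁻¹ j l * sff g p i j * sff g p k l

/-! ### Non-degenerate critical points on the boundary -/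

/-- The inclusion `y ↦ (0, y)` of the boundary of the half-space. -/
def inclBdry (y : EuclideanSpace ℝ (TIdx n)) : EuclideanSpace ℝ (Fin n) :=
  WithLp.toLp 2 fun i => if hi : i ≠ 0 then y ⟨i, hi⟩ else 0

/-- The tangential part of a coordinate vector. -/
def tangPart (x : EuclideanSpace ℝ (Fin n)) : EuclideanSpace ℝ (TIdx n) :=
  WithLp.toLp 2 fun i => x i.1

/-- The restriction of `f` to the boundary, read in the chart of the boundary at `p`. -/
def bdryRead (f : M → ℝ) (p : M) (y : EuclideanSpace ℝ (TIdx n)) : ℝ :=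
  f ((extChartAt (𝓡∂ n) p).symm (inclBdry y))

/-- Every critical point of the restriction of `f` to the boundary is non-degenerate: where the
differential vanishes, the Hessian is a non-degenerate bilinear form. -/
def OnlyNondegenerateCriticalPoints (f : M → ℝ) : Prop :=
  ∀ p ∈ (𝓡∂ n).boundary M,
    let y₀ := tangPart (extChartAt (𝓡∂ n) p p)
    fderiv ℝ (bdryRead (n := n) f p) y₀ = 0 →
      ∀ v, (∀ w, fderiv ℝ (fderiv ℝ (bdryRead (n := n) f p)) y₀ v w = 0) → v = 0

/-! ### The `C^m` norm -/

/-- A finite open covering of `M` by sets whose closures lie in the domains of charts. The charts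
may be any charts of the `C^{m+1}` structure. -/
structure ChartCover (n : ℕ) [NeZero n] (m : ℕ) (M : Type*) [TopologicalSpace M]
    [ChartedSpace (EuclideanHalfSpace n) M] where
  ι : Type
  [fintype : Fintype ι]
  V : ι → Set M
  isOpen : ∀ a, IsOpen (V a)
  iUnion_eq : ⋃ a, V a = univ
  chart : ι → OpenPartialHomeomorph M (EuclideanHalfSpace n)
  chart_mem : ∀ a, chart a ∈ IsManifold.maximalAtlas (𝓡∂ n) ((m : ℕ∞ω) + 1) M
  closure_subset : ∀ a, closure (V a) ⊆ (chart a).source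

attribute [instance] ChartCover.fintype

/-- The norm `‖k‖_m`: the sum over the charts and the components of the suprema of the derivatives
of order at most `m`. -/
def cmNorm {m : ℕ} (C : ChartCover n m M) (k : TensorField n M) : ℝ≥0∞ :=
  ∑ a, ∑ r ∈ Finset.range (m + 1), ∑ i, ∑ j,
    ⨆ x ∈ (C.chart a).extend (𝓡∂ n) '' C.V a,
      ‖iteratedFDerivWithin ℝ r (comp k (C.chart a) i j) (range (𝓡∂ n)) x‖ₑ

end Charts

section Spaces

variable {n : ℕ} [NeZero n] {m : ℕ} {M : Type*} [TopologicalSpace M]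
  [ChartedSpace (EuclideanHalfSpace n) M] [IsManifold (𝓡∂ n) 1 M]

/-- The topology on the `C^m` metrics given by the norm `‖·‖_m`: a set is open if with each `g` it
contains some ball `{g' : ‖g' - g‖_m < ε}`. -/
@[reducible] def cmTopology (C : ChartCover n m M) : TopologicalSpace (Metric n m M) where
  IsOpen U := ∀ g ∈ U, ∃ ε : ℝ≥0∞, 0 < ε ∧
    ∀ g' : Metric n m M, cmNorm C (fun p => g'.inner p - g.inner p) < ε → g' ∈ U
  isOpen_univ := fun _ _ => ⟨1, one_pos, fun _ _ => mem_univ _⟩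
  isOpen_inter := by
    rintro U V hU hV g ⟨h1, h2⟩
    obtain ⟨a, ha, ha'⟩ := hU g h1
    obtain ⟨b, hb, hb'⟩ := hV g h2
    exact ⟨min a b, lt_min ha hb, fun g' h =>
      ⟨ha' g' (h.trans_le (min_le_left _ _)), hb' g' (h.trans_le (min_le_right _ _))⟩⟩
  isOpen_sUnion := by
    rintro S hS g ⟨U, hU, hg⟩
    obtain ⟨a, ha, ha'⟩ := hS U hU g hg
    exact ⟨a, ha, fun g' h => ⟨U, hU, ha' g' h⟩⟩

variable (n m M) in
/-- The metrics whose boundary second fundamental form vanishes nowhere. -/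
def nowhereVanishing : Set (Metric n m M) :=
  {g | ∀ p ∈ (𝓡∂ n).boundary M, sff g.inner p ≠ 0}

variable (n m M) in
/-- The metrics for which the boundary is minimal. -/
def minimalBoundary : Set (Metric n m M) :=
  {g | ∀ p ∈ (𝓡∂ n).boundary M, meanCurv g.inner p = 0}

variable (n m M) in
/-- The metrics for which the squared norm of the second fundamental form has only non-degenerate
critical points on the boundary. -/
def nondegenerate : Set (Metric n m M) :=
  {g | OnlyNondegenerateCriticalPoints (n := n) (sffNormSq g.inner)}

end Spaces

end BoundaryMorse

end

/-!
Non-degeneracy of the critical points of `‖sff‖²` is a condition on the 2-jet, along the boundary,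
of the 1-jet of the metric, so it is stable under small `C^3` perturbations; as `∂M` is compact,
this gives openness (`isOpen_nondegAtPoint_of_isCompact`).

For density, metrics are changed conformally, `g' = exp(-v) g`, with a function `v` whose normal
derivative vanishes on the boundary. Such a change multiplies the second fundamental form by
`exp(-v/2)`, so it preserves both conditions that define the ambient space, and it multiplies
`‖sff‖²` by `exp(v)` (`jetSff_jetScale`, `sffNormSq_conformal`). On `{sff ≠ 0}` the function `φ = log ‖sff‖²` is of class `C^2` along the
boundary, and it is replaced by `φ + v`. In a boundary chart there are functions `uᵢ` with vanishing
normal derivative that restrict to the coordinates `yᵢ` near a given point of the boundary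
(`exists_isNeumannAt`); with `v = ∑ aᵢ uᵢ` the new function is `φ(y) + ⟨a, y⟩`. By Sard's theorem
for `-grad φ`, all its critical points are non-degenerate for almost every `a`
(`ae_nondegAt_add_linear`), in particular for arbitrarily small `a`, and `g'` tends to `g` in the
`C^m` norm as `a → 0` (`tendsto_cmNorm_conformal`). So the Morse condition over a suitable compact
neighbourhood of any given point is open and dense; finitely many such neighbourhoods cover `M`, and
a finite intersection of open dense sets is dense.

The second fundamental form and its norm are defined in the preferred chart at each point. That they
can be computed in any chart is a consequence of the transformation law of 1-jets of 2-tensors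
(`jet_eq_jetPullback`): the term with the second derivatives of the transition map drops out of
the second fundamental form because transition maps preserve the boundary
(`jetNormSq_jetPullback`).
-/

noncomputable section

namespace BoundaryMorse

set_option linter.unusedSectionVars false

open Filter Topology MeasureTheory

/-! ### Non-degenerate critical points -/

section Morse

variable {V W : Type*} [NormedAddCommGroup V] [NormedSpace ℝ V]
  [NormedAddCommGroup W] [NormedSpace ℝ W]

/-- The 2-jets `(dF, d²F)` at a point that are allowed for a Morse function. -/
def morseJets (V : Type*) [NormedAddCommGroup V] [NormedSpace ℝ V] :
    Set ((V →L[ℝ] ℝ) × (V →L[ℝ] V →L[ℝ] ℝ)) :=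
  {q | q.1 = 0 → ∀ v, (∀ w, q.2 v w = 0) → v = 0}

/-- If `y` is a critical point of `F`, then it is non-degenerate. -/
def NondegAt (F : V → ℝ) (y : V) : Prop :=
  (fderiv ℝ F y, fderiv ℝ (fderiv ℝ F) y) ∈ morseJets V

lemma NondegAt.congr {F G : V → ℝ} {y : V} (h : NondegAt G y) (hFG : F =ᶠ[𝓝 y] G) :
    NondegAt F y := by
  have h1 : fderiv ℝ F =ᶠ[𝓝 y] fderiv ℝ G := hFG.fderiv
  unfold NondegAt at *
  rwa [h1.eq_of_nhds, h1.fderiv_eq]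

/-- Non-degeneracy is open in the 2-jet, because the invertible operators `V → V*` form an open
set. -/
lemma isOpen_morseJets [FiniteDimensional ℝ V] : IsOpen (morseJets V) := by
  have h1 : IsOpen {q : (V →L[ℝ] ℝ) × (V →L[ℝ] V →L[ℝ] ℝ) | q.1 ≠ 0} :=
    isOpen_ne.preimage continuous_fst
  have h2 : IsOpen {q : (V →L[ℝ] ℝ) × (V →L[ℝ] V →L[ℝ] ℝ) | Function.Injective q.2} :=
    ContinuousLinearMap.isOpen_injective.preimage continuous_snd
  convert h1.union h2 using 1
  ext q
  simp only [morseJets, mem_ofPred_eq, mem_union]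
  have h3 : Function.Injective q.2 ↔ ∀ v, (∀ w, q.2 v w = 0) → v = 0 := by
    rw [injective_iff_map_eq_zero]
    refine forall_congr' fun v => ?_
    rw [ContinuousLinearMap.ext_iff]
    rfl
  rw [h3]
  tauto

/-- First and second derivatives of a composition. -/
lemma fderiv_fderiv_comp {X : Type*} [NormedAddCommGroup X] [NormedSpace ℝ X]
    {Φ : W → X} {ψ : V → W} {y : V}
    (hΦ : ContDiffAt ℝ 2 Φ (ψ y)) (hψ : ContDiffAt ℝ 2 ψ y) :
    fderiv ℝ (fun z => Φ (ψ z)) y = (fderiv ℝ Φ (ψ y)).comp (fderiv ℝ ψ y) ∧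
    fderiv ℝ (fderiv ℝ (fun z => Φ (ψ z))) y =
      (ContinuousLinearMap.compL ℝ V W X (fderiv ℝ Φ (ψ y))).comp (fderiv ℝ (fderiv ℝ ψ) y) +
      ((ContinuousLinearMap.compL ℝ V W X).flip (fderiv ℝ ψ y)).comp
        ((fderiv ℝ (fderiv ℝ Φ) (ψ y)).comp (fderiv ℝ ψ y)) := by
  have e1 : ∀ᶠ z in 𝓝 y, ContDiffAt ℝ 2 ψ z := hψ.eventually (by simp)
  have e2 : ∀ᶠ z in 𝓝 y, ContDiffAt ℝ 2 Φ (ψ z) :=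
    hψ.continuousAt.eventually (hΦ.eventually (by simp))
  have e3 : fderiv ℝ (fun z => Φ (ψ z)) =ᶠ[𝓝 y]
      fun z => (fderiv ℝ Φ (ψ z)).comp (fderiv ℝ ψ z) := by
    filter_upwards [e1, e2] with z h1 h2
    exact fderiv_comp z (h2.differentiableAt (by simp)) (h1.differentiableAt (by simp))
  refine ⟨e3.eq_of_nhds, ?_⟩
  rw [e3.fderiv_eq]
  have d1 : DifferentiableAt ℝ (fderiv ℝ ψ) y :=
    (hψ.fderiv_right (m := 1) le_rfl).differentiableAt (by simp)
  have d2 : DifferentiableAt ℝ (fderiv ℝ Φ) (ψ y) :=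
    (hΦ.fderiv_right (m := 1) le_rfl).differentiableAt (by simp)
  have d3 : DifferentiableAt ℝ ψ y := hψ.differentiableAt (by simp)
  have d4 := d2.hasFDerivAt.comp y d3.hasFDerivAt
  exact (d4.clm_comp d1.hasFDerivAt).fderiv

/-- Non-degeneracy of critical points is invariant under local diffeomorphisms. -/
lemma NondegAt.comp {Φ : W → ℝ} {ψ : V → W} {y : V} (h : NondegAt Φ (ψ y))
    (hΦ : ContDiffAt ℝ 2 Φ (ψ y)) (hψ : ContDiffAt ℝ 2 ψ y)
    (hb : Function.Bijective (fderiv ℝ ψ y)) : NondegAt (fun z => Φ (ψ z)) y := by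
  obtain ⟨h1, h2⟩ := fderiv_fderiv_comp hΦ hψ
  intro hcrit v hv
  simp only at hcrit hv
  rw [h1] at hcrit
  have hz : fderiv ℝ Φ (ψ y) = 0 := by
    ext w
    obtain ⟨v, rfl⟩ := hb.2 w
    exact DFunLike.congr_fun hcrit v
  apply (injective_iff_map_eq_zero _).1 hb.1
  refine h hz _ fun w => ?_
  obtain ⟨w, rfl⟩ := hb.2 w
  have := hv w
  rw [h2] at this
  simpa [hz] using this

/-- The critical points of `exp ∘ Φ` are those of `Φ`, with proportional Hessians. -/
lemma NondegAt.exp {Φ : V → ℝ} {y : V} (h : NondegAt Φ y) (hΦ : ContDiffAt ℝ 2 Φ y) :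
    NondegAt (fun z => Real.exp (Φ z)) y := by
  obtain ⟨h1, h2⟩ := fderiv_fderiv_comp (Φ := Real.exp) (ψ := Φ) Real.contDiff_exp.contDiffAt hΦ
  have hE : ∀ t s : ℝ, fderiv ℝ Real.exp t s = s * Real.exp t := fun t s => by
    rw [(Real.hasDerivAt_exp t).hasFDerivAt.fderiv]
    simp
  intro hcrit v hv
  simp only at hcrit hv
  have hz : fderiv ℝ Φ y = 0 := by
    ext w
    have := DFunLike.congr_fun hcrit w
    rw [h1] at this
    simpa [hE, Real.exp_ne_zero] using this
  refine h hz v fun w => ?_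
  have := hv w
  rw [h2] at this
  simpa [hz, hE, Real.exp_ne_zero] using this

/-- **Sard's theorem** for the gradient map: almost every linear perturbation of a `C²` function
has only non-degenerate critical points. -/
lemma ae_nondegAt_add_linear {V : Type*} [NormedAddCommGroup V] [InnerProductSpace ℝ V]
    [FiniteDimensional ℝ V] [MeasurableSpace V] [BorelSpace V] {φ : V → ℝ} {U : Set V}
    (hφ : ∀ y ∈ U, ContDiffAt ℝ 2 φ y) :
    ∀ᵐ a : V, ∀ y ∈ U, NondegAt (fun z => φ z + inner ℝ a z) y := by
  let D := (InnerProductSpace.toDual ℝ V).symm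
  let G : V → V := fun y => -D (fderiv ℝ φ y)
  let L : (V →L[ℝ] ℝ) →L[ℝ] V :=
    LinearMap.toContinuousLinearMap
      { toFun := fun l => -D l
        map_add' := fun l k => by rw [map_add, neg_add]
        map_smul' := fun c l => by simp }
  let G' : V → V →L[ℝ] V := fun y => L.comp (fderiv ℝ (fderiv ℝ φ) y)
  have hdd : ∀ y ∈ U, DifferentiableAt ℝ (fderiv ℝ φ) y := fun y hy =>
    ((hφ y hy).fderiv_right (m := 1) le_rfl).differentiableAt (by simp)
  have hG : ∀ y ∈ U, HasFDerivAt G (G' y) y := fun y hy =>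
    L.hasFDerivAt.comp y (hdd y hy).hasFDerivAt
  -- If `y` is a degenerate critical point of `φ + ⟨a, ·⟩`, then `a = -grad φ (y)` is a critical
  -- value of `G = -grad φ`.
  let S : Set V := {y | y ∈ U ∧ (G' y).det = 0}
  have hS : (volume : Measure V) (G '' S) = 0 :=
    addHaar_image_eq_zero_of_det_fderivWithin_eq_zero volume
      (fun y hy => (hG y hy.1).hasFDerivWithinAt) (fun y hy => hy.2)
  have hae : ∀ᵐ a : V, a ∉ G '' S := measure_eq_zero_iff_ae_notMem.1 hS
  filter_upwards [hae] with a ha y hy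
  have hd : ∀ z, ContDiffAt ℝ 2 φ z →
      fderiv ℝ (fun z => φ z + inner ℝ a z) z = fderiv ℝ φ z + innerSL ℝ a := by
    intro z hz
    have h1 : DifferentiableAt ℝ φ z := hz.differentiableAt (by simp)
    exact (h1.hasFDerivAt.add (innerSL ℝ a).hasFDerivAt).fderiv
  have hev : fderiv ℝ (fun z => φ z + inner ℝ a z) =ᶠ[𝓝 y]
      fun z => fderiv ℝ φ z + innerSL ℝ a :=
    ((hφ y hy).eventually (by simp)).mono hd
  have hs : fderiv ℝ (fderiv ℝ (fun z => φ z + inner ℝ a z)) y = fderiv ℝ (fderiv ℝ φ) y := by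
    rw [hev.fderiv_eq, fderiv_add_const]
  intro hcrit v hv
  simp only at hcrit hv
  rw [hs] at hv
  rw [hev.eq_of_nhds] at hcrit
  by_contra hv0
  refine ha ⟨y, ⟨hy, ?_⟩, ?_⟩
  · by_contra hdet
    have hinj : Function.Injective (G' y) := by
      have : LinearMap.ker ((G' y : V →L[ℝ] V) : V →ₗ[ℝ] V) = ⊥ := by
        by_contra hk
        exact hdet (LinearMap.det_eq_zero_iff_ker_ne_bot.2 hk)
      exact LinearMap.ker_eq_bot.1 this
    refine hv0 ((injective_iff_map_eq_zero _).1 hinj v ?_)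
    have : fderiv ℝ (fderiv ℝ φ) y v = 0 := by
      ext w; exact hv w
    simp [G', this]
  · have h1 : fderiv ℝ φ y = -(innerSL ℝ a) := eq_neg_of_add_eq_zero_left hcrit
    have h2 : (innerSL ℝ a : V →L[ℝ] ℝ) = InnerProductSpace.toDual ℝ V a := rfl
    simp [G, D, h1, h2]

end Morse

/-! ### The second fundamental form as a function of the 1-jet of the metric -/

section Jets

variable {n : ℕ} [NeZero n]

/-- First-order jets of covariant 2-tensors in coordinates: `w.1 i j` stands for `k_{ij}` and
`w.2 c i j` for `∂_c k_{ij}`. -/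
abbrev Jet (n : ℕ) := (Fin n → Fin n → ℝ) × (Fin n → Fin n → Fin n → ℝ)

/-- The matrix of the tensor. -/
def jetGram (w : Jet n) : Matrix (Fin n) (Fin n) ℝ := Matrix.of w.1

/-- The tangential block of the matrix of the tensor. -/
def jetBdry (w : Jet n) : Matrix (TIdx n) (TIdx n) ℝ :=
  (jetGram w).submatrix Subtype.val Subtype.val

/-- Christoffel symbols of the first kind, as functions of the jet. -/
def jetChristoffel (w : Jet n) (i j d : Fin n) : ℝ :=
  (w.2 i j d + w.2 j i d - w.2 d i j) / 2

/-- The components of the unit normal, as functions of the jet. -/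
def jetNormal (w : Jet n) (d : Fin n) : ℝ :=
  (jetGram w)⁻¹ d 0 / Real.sqrt ((jetGram w)⁻¹ 0 0)

/-- The second fundamental form, as a function of the jet. -/
def jetSff (w : Jet n) : Matrix (TIdx n) (TIdx n) ℝ :=
  Matrix.of fun i j => ∑ d, jetChristoffel w i j d * jetNormal w d

/-- The boundary mean curvature, as a function of the jet. -/
def jetMean (w : Jet n) : ℝ := ∑ i, ∑ j, (jetBdry w)⁻¹ i j * jetSff w i j

/-- The squared norm of the second fundamental form, as a function of the jet. -/
def jetNormSq (w : Jet n) : ℝ :=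
  ∑ i, ∑ j, ∑ k, ∑ l,
    (jetBdry w)⁻¹ i k * (jetBdry w)⁻¹ j l * jetSff w i j * jetSff w k l

/-! ### Regularity of the squared norm of the second fundamental form as a function of the jet -/

lemma contDiffAt_inv_apply {ι : Type*} [Fintype ι] [DecidableEq ι] {k : ℕ∞ω}
    {A : ι → ι → ℝ} (hA : (Matrix.of A).det ≠ 0) (i j : ι) :
    ContDiffAt ℝ k (fun B : ι → ι → ℝ => (Matrix.of B)⁻¹ i j) A := by
  have hdet : ∀ F : (ι → ι → ℝ) → Matrix ι ι ℝ, (∀ a b, ContDiffAt ℝ k (fun B => F B a b) A) →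
      ContDiffAt ℝ k (fun B => (F B).det) A := by
    intro F hF
    simp only [Matrix.det_apply']
    exact ContDiffAt.sum fun σ _ => contDiffAt_const.mul (contDiffAt_prod fun a _ => hF _ _)
  have h0 : ∀ a b, ContDiffAt ℝ k (fun B : ι → ι → ℝ => B a b) A := fun a b => by fun_prop
  have h1 : ContDiffAt ℝ k (fun B : ι → ι → ℝ => (Matrix.of B).det) A := hdet _ h0
  have h2 : ContDiffAt ℝ k (fun B : ι → ι → ℝ => (Matrix.of B).adjugate i j) A := by
    simp only [Matrix.adjugate_apply]
    refine hdet _ fun a b => ?_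
    simp only [Matrix.updateRow_apply]
    split_ifs
    · exact contDiffAt_const
    · exact h0 a b
  simp only [Matrix.inv_def, Ring.inverse_eq_inv', Matrix.smul_apply, smul_eq_mul]
  exact (h1.inv hA).mul h2

lemma jetBdry_posDef {w : Jet n} (hw : (jetGram w).PosDef) : (jetBdry w).PosDef :=
  hw.submatrix Subtype.val_injective

lemma contDiffAt_jetNormSq {k : ℕ∞ω} {w : Jet n} (hw : (jetGram w).PosDef) :
    ContDiffAt ℝ k (jetNormSq (n := n)) w := by
  have hG : ∀ i j, ContDiffAt ℝ k (fun w : Jet n => (jetGram w)⁻¹ i j) w := fun i j =>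
    (contDiffAt_inv_apply (A := w.1) (hw.det_pos.ne') i j).comp w contDiffAt_fst
  have hB : ∀ i j, ContDiffAt ℝ k (fun w : Jet n => (jetBdry w)⁻¹ i j) w := fun i j => by
    have h1 : ContDiffAt ℝ k (fun w : Jet n => fun a b : TIdx n => w.1 a.1 b.1) w := by fun_prop
    exact ContDiffAt.comp (g := fun B : TIdx n → TIdx n → ℝ => (Matrix.of B)⁻¹ i j) w
      (contDiffAt_inv_apply (jetBdry_posDef hw).det_pos.ne' i j) h1
  have hpos : (jetGram w)⁻¹ 0 0 ≠ 0 := hw.inv.diag_pos.ne'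
  have hN : ∀ d, ContDiffAt ℝ k (fun w : Jet n => jetNormal w d) w := fun d =>
    (hG d 0).div ((hG 0 0).sqrt hpos) (Real.sqrt_ne_zero'.2 hw.inv.diag_pos)
  have hS : ∀ i j, ContDiffAt ℝ k (fun w : Jet n => jetSff w i j) w := fun i j => by
    have hC : ∀ d, ContDiffAt ℝ k (fun w : Jet n => jetChristoffel w i j d) w := fun d => by
      unfold jetChristoffel
      fun_prop
    change ContDiffAt ℝ k (fun w : Jet n => ∑ d, jetChristoffel w i j d * jetNormal w d) w
    exact ContDiffAt.sum fun d _ => (hC d).mul (hN d)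
  unfold jetNormSq
  exact ContDiffAt.sum fun i _ => ContDiffAt.sum fun j _ => ContDiffAt.sum fun k _ =>
    ContDiffAt.sum fun l _ => (((hB _ _).mul (hB _ _)).mul (hS _ _)).mul (hS _ _)

open scoped Kronecker in
lemma jetNormSq_pos {w : Jet n} (hw : (jetGram w).PosDef) (h : jetSff w ≠ 0) :
    0 < jetNormSq w := by
  have hK := (jetBdry_posDef hw).inv.kronecker (jetBdry_posDef hw).inv
  let x : TIdx n × TIdx n → ℝ := fun q => jetSff w q.1 q.2
  have hx : x ≠ 0 := fun h0 => h (by ext i j; exact congrFun h0 (i, j))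
  have hpos := hK.dotProduct_mulVec_pos hx
  have heq : jetNormSq w =
      dotProduct (star x) (Matrix.mulVec ((jetBdry w)⁻¹ ⊗ₖ (jetBdry w)⁻¹) x) := by
    unfold jetNormSq dotProduct Matrix.mulVec dotProduct
    simp only [Fintype.sum_prod_type, Matrix.kroneckerMap_apply, Finset.mul_sum, Pi.star_apply,
      star_trivial, x]
    refine Finset.sum_congr rfl fun i _ => Finset.sum_congr rfl fun j _ =>
      Finset.sum_congr rfl fun k _ => Finset.sum_congr rfl fun l _ => by ring
  rw [heq]
  exact hpos

/-! ### Conformal changes -/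

/-- The jet of `λ k`, where `k` has jet `w`, and `λ` has value `c` and differential `β`. -/
def jetScale (c : ℝ) (β : Fin n → ℝ) (w : Jet n) : Jet n :=
  (fun i j => c * w.1 i j, fun a i j => c * w.2 a i j + β a * w.1 i j)

lemma sum_gram_mul_normal {w : Jet n} (hw : (jetGram w).PosDef) {j : Fin n} (hj : j ≠ 0) :
    ∑ d, w.1 j d * jetNormal w d = 0 := by
  have h1 : (jetGram w * (jetGram w)⁻¹) j 0 = 0 := by
    rw [Matrix.mul_nonsing_inv _ hw.det_pos.ne'.isUnit, Matrix.one_apply_ne hj]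
  rw [Matrix.mul_apply] at h1
  simp only [jetNormal, mul_div_assoc']
  rw [← Finset.sum_div]
  exact div_eq_zero_iff.2 (Or.inl h1)

section Conformal

variable {c : ℝ} {β : Fin n → ℝ} {w : Jet n}

omit [NeZero n] in
lemma jetGram_jetScale : jetGram (jetScale c β w) = c • jetGram w := by
  ext i j; simp [jetGram, jetScale]

omit [NeZero n] in
lemma inv_jetGram_jetScale (hc : 0 < c) (hw : (jetGram w).PosDef) :
    (jetGram (jetScale c β w))⁻¹ = c⁻¹ • (jetGram w)⁻¹ := by
  rw [jetGram_jetScale]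
  exact Matrix.inv_smul' (jetGram w) (Units.mk0 c hc.ne') hw.det_pos.ne'.isUnit

lemma inv_jetBdry_jetScale (hc : 0 < c) (hw : (jetGram w).PosDef) :
    (jetBdry (jetScale c β w))⁻¹ = c⁻¹ • (jetBdry w)⁻¹ := by
  have : jetBdry (jetScale c β w) = c • jetBdry w := by
    ext i j; simp [jetBdry, jetGram, jetScale]
  rw [this]
  exact Matrix.inv_smul' (jetBdry w) (Units.mk0 c hc.ne') (jetBdry_posDef hw).det_pos.ne'.isUnit

lemma jetNormal_jetScale (hc : 0 < c) (hw : (jetGram w).PosDef) (d : Fin n) :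
    jetNormal (jetScale c β w) d = (Real.sqrt c)⁻¹ * jetNormal w d := by
  have h1 : Real.sqrt c ≠ 0 := Real.sqrt_ne_zero'.2 hc
  have h2 : Real.sqrt ((jetGram w)⁻¹ 0 0) ≠ 0 := Real.sqrt_ne_zero'.2 hw.inv.diag_pos
  have h3 : Real.sqrt c * Real.sqrt c = c := Real.mul_self_sqrt hc.le
  simp only [jetNormal, inv_jetGram_jetScale hc hw, Matrix.smul_apply, smul_eq_mul]
  rw [Real.sqrt_mul (by positivity), Real.sqrt_inv]
  field_simp
  rw [sq, h3, mul_comm]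

/-- A conformal change with vanishing normal derivative at the boundary only rescales the second
fundamental form. -/
lemma jetSff_jetScale (hc : 0 < c) (hw : (jetGram w).PosDef)
    (hβ : ∑ d, (jetGram w)⁻¹ 0 d * β d = 0) :
    jetSff (jetScale c β w) = Real.sqrt c • jetSff w := by
  have h3 : Real.sqrt c * Real.sqrt c = c := Real.mul_self_sqrt hc.le
  have h1 : Real.sqrt c ≠ 0 := Real.sqrt_ne_zero'.2 hc
  have hc' : (Real.sqrt c)⁻¹ * c = Real.sqrt c := by
    nth_rewrite 2 [← h3]
    field_simp
  have hsymm : (jetGram w)⁻¹.IsHermitian := hw.inv.1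
  have hβν : ∑ d, β d * jetNormal w d = 0 := by
    simp only [jetNormal, mul_div_assoc']
    rw [← Finset.sum_div]
    refine div_eq_zero_iff.2 (Or.inl ?_)
    rw [← hβ]
    refine Finset.sum_congr rfl fun d _ => ?_
    rw [← hsymm.apply 0 d]
    simp [mul_comm]
  ext i j
  have hi := sum_gram_mul_normal hw i.2
  have hj := sum_gram_mul_normal hw j.2
  have key : ∀ d, jetChristoffel (jetScale c β w) i j d * jetNormal (jetScale c β w) d =
      (Real.sqrt c)⁻¹ * (c * (jetChristoffel w i j d * jetNormal w d)
        + β i / 2 * (w.1 j d * jetNormal w d) + β j / 2 * (w.1 i d * jetNormal w d)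
        - w.1 i j / 2 * (β d * jetNormal w d)) := by
    intro d
    rw [jetNormal_jetScale hc hw]
    simp only [jetChristoffel, jetScale]
    ring
  simp only [jetSff, Matrix.of_apply, Matrix.smul_apply, smul_eq_mul]
  simp only [key]
  rw [← Finset.mul_sum, Finset.sum_sub_distrib, Finset.sum_add_distrib, Finset.sum_add_distrib,
    ← Finset.mul_sum, ← Finset.mul_sum, ← Finset.mul_sum, ← Finset.mul_sum, hi, hj, hβν]
  simp only [mul_zero, add_zero, sub_zero, ← mul_assoc, hc']

lemma jetMean_jetScale (hc : 0 < c) (hw : (jetGram w).PosDef)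
    (hβ : ∑ d, (jetGram w)⁻¹ 0 d * β d = 0) (h0 : jetMean w = 0) :
    jetMean (jetScale c β w) = 0 := by
  have : jetMean (jetScale c β w) = c⁻¹ * Real.sqrt c * jetMean w := by
    simp only [jetMean, jetSff_jetScale hc hw hβ, inv_jetBdry_jetScale hc hw, Matrix.smul_apply,
      smul_eq_mul, Finset.mul_sum]
    refine Finset.sum_congr rfl fun i _ => Finset.sum_congr rfl fun j _ => by ring
  rw [this, h0, mul_zero]

lemma jetNormSq_jetScale (hc : 0 < c) (hw : (jetGram w).PosDef)
    (hβ : ∑ d, (jetGram w)⁻¹ 0 d * β d = 0) :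
    jetNormSq (jetScale c β w) = c⁻¹ * jetNormSq w := by
  have h3 : c = Real.sqrt c * Real.sqrt c := (Real.mul_self_sqrt hc.le).symm
  have hc' : c⁻¹ * c⁻¹ * Real.sqrt c * Real.sqrt c = c⁻¹ := by
    rw [mul_assoc, ← h3]; field_simp
  simp only [jetNormSq, jetSff_jetScale hc hw hβ, inv_jetBdry_jetScale hc hw, Matrix.smul_apply,
      smul_eq_mul, Finset.mul_sum]
  refine Finset.sum_congr rfl fun i _ => Finset.sum_congr rfl fun j _ =>
    Finset.sum_congr rfl fun k _ => Finset.sum_congr rfl fun l _ => ?_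
  linear_combination (jetBdry w)⁻¹ i k * (jetBdry w)⁻¹ j l * jetSff w i j * jetSff w k l * hc'

end Conformal

/-! ### Changes of coordinates -/

/-- The transformation law of jets of covariant 2-tensors under a change of coordinates with
Jacobian matrix `J a i = ∂_i φ^a` and second derivatives `Q a c i = ∂_c ∂_i φ^a`. -/
def jetPullback (J : Matrix (Fin n) (Fin n) ℝ) (Q : Fin n → Fin n → Fin n → ℝ) (w : Jet n) :
    Jet n :=
  (fun i j => ∑ a, ∑ b, J a i * J b j * w.1 a b,
    fun c i j => ∑ a, ∑ b, (Q a c i * J b j * w.1 a b + J a i * Q b c j * w.1 a b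
      + J a i * J b j * ∑ e, J e c * w.2 e a b))

section Pullback

variable {J : Matrix (Fin n) (Fin n) ℝ} {Q : Fin n → Fin n → Fin n → ℝ} {w : Jet n}

omit [NeZero n] in
lemma jetGram_jetPullback : jetGram (jetPullback J Q w) = J.transpose * jetGram w * J := by
  ext i j
  simp only [jetGram, jetPullback, Matrix.of_apply, Matrix.mul_apply, Matrix.transpose_apply,
    Finset.sum_mul]
  rw [Finset.sum_comm]
  refine Finset.sum_congr rfl fun i _ => Finset.sum_congr rfl fun j _ => by ring

omit [NeZero n] in
lemma sum_rotate {α β γ : Type*} [Fintype α] [Fintype β] [Fintype γ] (f : α → β → γ → ℝ) :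
    ∑ a, ∑ b, ∑ e, f a b e = ∑ e, ∑ a, ∑ b, f a b e := by
  rw [Finset.sum_congr rfl fun a _ => Finset.sum_comm, Finset.sum_comm]

omit [NeZero n] in
/-- The Christoffel symbols of the first kind transform like a tensor, up to a term with the second
derivatives of the change of coordinates. -/
lemma jetChristoffel_jetPullback (hQ : ∀ a c i, Q a c i = Q a i c)
    (hw : ∀ a b, w.1 a b = w.1 b a) (i j d : Fin n) :
    jetChristoffel (jetPullback J Q w) i j d =
      ∑ b, J b d * (∑ a, Q a i j * w.1 a b) +
      ∑ e, J e d * ∑ a, ∑ b, J a i * J b j * jetChristoffel w a b e := by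
  let P : Fin n → Fin n → Fin n → ℝ := fun c i j => ∑ a, ∑ b, Q a c i * J b j * w.1 a b
  let R : Fin n → Fin n → Fin n → ℝ := fun c i j =>
    ∑ a, ∑ b, ∑ e, J a i * J b j * J e c * w.2 e a b
  have hP : ∀ c i j, P c i j = P i c j := fun c i j => by
    simp only [P]
    refine Finset.sum_congr rfl fun a _ => Finset.sum_congr rfl fun b _ => by rw [hQ a c i]
  have h2 : ∀ c i j, (jetPullback J Q w).2 c i j = P c i j + P c j i + R c i j := by
    intro c i j
    have h3 : P c j i = ∑ a, ∑ b, J a i * Q b c j * w.1 a b := by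
      simp only [P]
      rw [Finset.sum_comm]
      refine Finset.sum_congr rfl fun a _ => Finset.sum_congr rfl fun b _ => ?_
      rw [hw a b]; ring
    rw [h3]
    simp only [jetPullback, P, R, Finset.mul_sum, Finset.sum_add_distrib, mul_assoc]
  have hR1 : R i j d = ∑ e, ∑ a, ∑ b, J e d * (J a i * J b j * w.2 a b e) := by
    simp only [R]
    rw [Finset.sum_comm]
    refine Finset.sum_congr rfl fun e _ => ?_
    rw [Finset.sum_comm]
    refine Finset.sum_congr rfl fun a _ => Finset.sum_congr rfl fun b _ => by ring
  have hR2 : R j i d = ∑ e, ∑ a, ∑ b, J e d * (J a i * J b j * w.2 b a e) := by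
    simp only [R]
    rw [Finset.sum_comm]
    refine Finset.sum_congr rfl fun e _ => ?_
    refine Finset.sum_congr rfl fun a _ => Finset.sum_congr rfl fun b _ => by ring
  have hR3 : R d i j = ∑ e, ∑ a, ∑ b, J e d * (J a i * J b j * w.2 e a b) := by
    simp only [R]
    rw [sum_rotate]
    refine Finset.sum_congr rfl fun e _ => Finset.sum_congr rfl fun a _ =>
      Finset.sum_congr rfl fun b _ => by ring
  have hP1 : P i j d = ∑ b, J b d * (∑ a, Q a i j * w.1 a b) := by
    simp only [P, Finset.mul_sum]
    rw [Finset.sum_comm]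
    refine Finset.sum_congr rfl fun a _ => Finset.sum_congr rfl fun b _ => by ring
  have hR : (R i j d + R j i d - R d i j) / 2 =
      ∑ e, J e d * ∑ a, ∑ b, J a i * J b j * jetChristoffel w a b e := by
    rw [hR1, hR2, hR3]
    simp only [Finset.mul_sum, ← Finset.sum_add_distrib, ← Finset.sum_sub_distrib,
      Finset.sum_div, jetChristoffel]
    refine Finset.sum_congr rfl fun e _ => Finset.sum_congr rfl fun a _ =>
      Finset.sum_congr rfl fun b _ => by ring
  rw [← hR, ← hP1, jetChristoffel, h2, h2, h2, hP j i d, hP i d j, hP j d i]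
  ring

lemma sum_eq_sum_tIdx {f : Fin n → ℝ} (h0 : f 0 = 0) : ∑ a, f a = ∑ a : TIdx n, f a := by
  rw [← Finset.sum_subtype (Finset.univ.filter fun a : Fin n => a ≠ 0) (by simp) f,
    Finset.sum_filter]
  refine Finset.sum_congr rfl fun a _ => ?_
  split_ifs with h
  · rfl
  · rw [not_not.1 h, h0]

/-- The tangential block of the Jacobian matrix of a change of coordinates. -/
def tangBlock (J : Matrix (Fin n) (Fin n) ℝ) : Matrix (TIdx n) (TIdx n) ℝ :=
  J.submatrix Subtype.val Subtype.val

variable (hJ : ∀ i, i ≠ 0 → J 0 i = 0)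
include hJ

lemma jetBdry_jetPullback :
    jetBdry (jetPullback J Q w) = (tangBlock J).transpose * jetBdry w * tangBlock J := by
  ext i j
  simp only [jetBdry, jetGram, tangBlock, jetPullback, Matrix.of_apply, Matrix.mul_apply,
    Matrix.transpose_apply, Matrix.submatrix_apply, Finset.sum_mul]
  rw [Finset.sum_comm]
  rw [sum_eq_sum_tIdx (by simp [hJ j j.2])]
  refine Finset.sum_congr rfl fun b _ => ?_
  rw [sum_eq_sum_tIdx (by simp [hJ i i.2])]
  refine Finset.sum_congr rfl fun a _ => by ring

variable (hw : (jetGram w).PosDef) (hw' : (jetGram (jetPullback J Q w)).PosDef)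
include hw hw'

omit [NeZero n] hJ hw in
lemma isUnit_det_of_posDef_jetPullback : IsUnit J.det := by
  have := hw'.det_pos.ne'
  rw [jetGram_jetPullback, Matrix.det_mul] at this
  exact (right_ne_zero_of_mul this).isUnit

omit [NeZero n] hJ hw in
lemma inv_jetGram_eq :
    (jetGram w)⁻¹ = J * (jetGram (jetPullback J Q w))⁻¹ * J.transpose := by
  have hu := isUnit_det_of_posDef_jetPullback hw'
  have hut : IsUnit J.transpose.det := by rwa [Matrix.det_transpose]
  rw [jetGram_jetPullback, Matrix.mul_inv_rev, Matrix.mul_inv_rev]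
  rw [Matrix.mul_nonsing_inv_cancel_left _ _ hu, Matrix.mul_assoc,
    Matrix.nonsing_inv_mul _ hut, Matrix.mul_one]

omit hw in
lemma inv_jetGram_apply_zero (a : Fin n) :
    (jetGram w)⁻¹ a 0 = J 0 0 * ∑ d, J a d * (jetGram (jetPullback J Q w))⁻¹ d 0 := by
  rw [inv_jetGram_eq hw', Matrix.mul_apply, Finset.sum_eq_single 0]
  · rw [Matrix.mul_apply, Matrix.transpose_apply, mul_comm]
  · intro b _ hb
    rw [Matrix.transpose_apply, hJ b hb, mul_zero]
  · simp

/-- The unit normal is a vector, up to the sign of the Jacobian in the normal direction. -/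
lemma exists_sign_jetNormal : ∃ s : ℝ, s * s = 1 ∧
    ∀ a, ∑ d, J a d * jetNormal (jetPullback J Q w) d = s * jetNormal w a := by
  set G := (jetGram (jetPullback J Q w))⁻¹ with hG
  have hpos : 0 < G 0 0 := hw'.inv.diag_pos
  have hpos' : 0 < (jetGram w)⁻¹ 0 0 := hw.inv.diag_pos
  have h00 : (jetGram w)⁻¹ 0 0 = J 0 0 ^ 2 * G 0 0 := by
    rw [inv_jetGram_apply_zero hJ hw', Finset.sum_eq_single 0]
    · ring
    · intro b _ hb
      rw [hJ b hb, zero_mul]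
    · simp
  have hJ0 : J 0 0 ≠ 0 := by
    intro h
    rw [h00, h] at hpos'
    simp at hpos'
  refine ⟨|J 0 0| / J 0 0, ?_, fun a => ?_⟩
  · rw [div_mul_div_comm, abs_mul_abs_self, div_self (mul_ne_zero hJ0 hJ0)]
  · simp only [jetNormal]
    rw [h00, Real.sqrt_mul (sq_nonneg _), Real.sqrt_sq_eq_abs, inv_jetGram_apply_zero hJ hw',
      ← hG]
    simp only [mul_div_assoc']
    rw [← Finset.sum_div]
    have h1 : |J 0 0| ≠ 0 := abs_ne_zero.2 hJ0
    have h2 := Real.sqrt_ne_zero'.2 hpos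
    field_simp

/-- Up to sign, the second fundamental form is a tensor on the boundary. The term with the second
derivatives of the change of coordinates drops out, because the function `φ^0` vanishes on the
boundary. -/
lemma exists_sign_jetSff (hQ : ∀ a c i, Q a c i = Q a i c)
    (hQ0 : ∀ i j, i ≠ 0 → j ≠ 0 → Q 0 i j = 0) : ∃ s : ℝ, s * s = 1 ∧
    jetSff (jetPullback J Q w) = s • ((tangBlock J).transpose * jetSff w * tangBlock J) := by
  obtain ⟨s, hs, hν⟩ := exists_sign_jetNormal hJ hw hw'
  refine ⟨s, hs, ?_⟩
  have hsymm : ∀ a b, w.1 a b = w.1 b a := fun a b => by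
    simpa [jetGram] using (hw.1.apply a b).symm
  ext i j
  have hQw : ∑ b, (∑ a, Q a i j * w.1 a b) * jetNormal w b = 0 := by
    simp only [Finset.sum_mul]
    rw [Finset.sum_comm]
    refine Finset.sum_eq_zero fun a _ => ?_
    by_cases ha : a = 0
    · subst ha
      simp [hQ0 i j i.2 j.2]
    · simp only [mul_assoc]
      rw [← Finset.mul_sum, sum_gram_mul_normal hw ha, mul_zero]
  have key : ∀ f : Fin n → ℝ, ∑ d, (∑ b, J b d * f b) * jetNormal (jetPullback J Q w) d =
      s * ∑ b, f b * jetNormal w b := by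
    intro f
    simp only [Finset.sum_mul, Finset.mul_sum]
    rw [Finset.sum_comm]
    refine Finset.sum_congr rfl fun b _ => ?_
    calc _ = f b * ∑ d, J b d * jetNormal (jetPullback J Q w) d := by
          rw [Finset.mul_sum]
          exact Finset.sum_congr rfl fun d _ => by ring
      _ = _ := by rw [hν]; ring
  simp only [jetSff, Matrix.of_apply, Matrix.smul_apply, smul_eq_mul]
  simp only [jetChristoffel_jetPullback hQ hsymm, add_mul, Finset.sum_add_distrib, key, hQw,
    mul_zero, zero_add]
  congr 1
  have hl : ∑ e, (∑ a, ∑ b, J a i * J b j * jetChristoffel w a b e) * jetNormal w e =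
      ∑ a, ∑ b, J a i * J b j * ∑ e, jetChristoffel w a b e * jetNormal w e := by
    simp only [Finset.sum_mul, Finset.mul_sum]
    rw [← sum_rotate]
    simp only [mul_assoc]
  have hl' : ∀ a : TIdx n, ∑ b, J a i * J b j * ∑ e, jetChristoffel w a b e * jetNormal w e =
      ∑ b : TIdx n, J a i * J b j * ∑ e, jetChristoffel w a b e * jetNormal w e := fun a =>
    sum_eq_sum_tIdx (by simp [hJ j j.2])
  rw [hl, sum_eq_sum_tIdx (by simp [hJ i i.2])]
  simp only [hl']
  simp only [tangBlock, Matrix.mul_apply, Matrix.of_apply, Matrix.transpose_apply,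
    Matrix.submatrix_apply, Finset.sum_mul]
  rw [Finset.sum_comm]
  refine Finset.sum_congr rfl fun b _ => Finset.sum_congr rfl fun a _ => ?_
  ring

omit hJ hw hw' in
lemma jetNormSq_eq_trace (w : Jet n) : jetNormSq w =
    (((jetBdry w)⁻¹.transpose * jetSff w) * ((jetBdry w)⁻¹ * (jetSff w).transpose)).trace := by
  simp only [jetNormSq, Matrix.trace, Matrix.diag_apply, Matrix.mul_apply, Matrix.transpose_apply]
  rw [sum_rotate]
  refine Finset.sum_congr rfl fun k _ => ?_
  rw [Finset.sum_comm]
  refine Finset.sum_congr rfl fun j _ => ?_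
  rw [Finset.sum_mul_sum]
  refine Finset.sum_congr rfl fun i _ => Finset.sum_congr rfl fun l _ => by ring

/-- The squared norm of the second fundamental form does not depend on the coordinates. -/
lemma jetNormSq_jetPullback (hQ : ∀ a c i, Q a c i = Q a i c)
    (hQ0 : ∀ i j, i ≠ 0 → j ≠ 0 → Q 0 i j = 0) :
    jetNormSq (jetPullback J Q w) = jetNormSq w := by
  obtain ⟨s, hs, hS⟩ := exists_sign_jetSff hJ hw hw' hQ hQ0
  have hb := jetBdry_jetPullback (Q := Q) (w := w) hJ
  have hB : IsUnit (tangBlock J).det := by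
    have := (jetBdry_posDef hw').det_pos.ne'
    rw [hb, Matrix.det_mul] at this
    exact (right_ne_zero_of_mul this).isUnit
  have hBt : IsUnit (tangBlock J).transpose.det := by rwa [Matrix.det_transpose]
  set B := tangBlock J
  set b := jetBdry w
  set S := jetSff w
  have hbi : (jetBdry (jetPullback J Q w))⁻¹ = B⁻¹ * b⁻¹ * B.transpose⁻¹ := by
    rw [hb, Matrix.mul_inv_rev, Matrix.mul_inv_rev, Matrix.mul_assoc]
  have h1 : (jetBdry (jetPullback J Q w))⁻¹.transpose * jetSff (jetPullback J Q w) =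
      s • (B⁻¹ * (b⁻¹.transpose * S) * B) := by
    rw [hbi, hS, Matrix.transpose_mul, Matrix.transpose_mul, Matrix.transpose_nonsing_inv B.transpose,
      Matrix.transpose_transpose, Matrix.transpose_nonsing_inv B, Matrix.mul_smul]
    congr 1
    simp only [Matrix.mul_assoc]
    rw [Matrix.nonsing_inv_mul_cancel_left _ _ hBt]
  have h2 : (jetBdry (jetPullback J Q w))⁻¹ * (jetSff (jetPullback J Q w)).transpose =
      s • (B⁻¹ * (b⁻¹ * S.transpose) * B) := by
    rw [hbi, hS, Matrix.transpose_smul, Matrix.transpose_mul, Matrix.transpose_mul,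
      Matrix.transpose_transpose, Matrix.mul_smul]
    congr 1
    simp only [Matrix.mul_assoc]
    rw [Matrix.nonsing_inv_mul_cancel_left _ _ hBt]
  rw [jetNormSq_eq_trace, jetNormSq_eq_trace, h1, h2, Matrix.smul_mul, Matrix.mul_smul, smul_smul,
    hs, one_smul]
  rw [Matrix.mul_assoc (B⁻¹ * _) B, Matrix.mul_assoc B⁻¹ (b⁻¹ * _) B,
    Matrix.mul_nonsing_inv_cancel_left _ _ hB, Matrix.mul_assoc B⁻¹, Matrix.trace_mul_comm,
    Matrix.mul_assoc, Matrix.mul_assoc, Matrix.mul_nonsing_inv_cancel_right _ _ hB, Matrix.mul_assoc]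

omit hw in
/-- The normal derivative of a function with differential `β` vanishes in one coordinate system
if it does so in the other one. -/
lemma sum_inv_jetGram_mul_eq_zero {β : Fin n → ℝ}
    (hβ : ∑ a, (jetGram w)⁻¹ 0 a * β a = 0) :
    ∑ d, (jetGram (jetPullback J Q w))⁻¹ 0 d * ∑ a, J a d * β a = 0 := by
  set G := (jetGram (jetPullback J Q w))⁻¹ with hG
  have hu := isUnit_det_of_posDef_jetPullback hw'
  have h1 : (J * G * J.transpose).mulVec β 0 = 0 := by
    rw [← inv_jetGram_eq hw']
    exact hβ
  have h2 : J 0 0 * (G * J.transpose).mulVec β 0 = 0 := by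
    rw [Matrix.mul_assoc, ← Matrix.mulVec_mulVec] at h1
    rw [← h1]
    symm
    change ∑ b, J 0 b * (G * J.transpose).mulVec β b = _
    rw [Finset.sum_eq_single 0 (fun b _ hb => by rw [hJ b hb, zero_mul]) (by simp)]
  have hJ0 : J 0 0 ≠ 0 := by
    intro h0
    refine hu.ne_zero (Matrix.det_eq_zero_of_row_eq_zero 0 fun j => ?_)
    by_cases hj : j = 0
    · rw [hj, h0]
    · exact hJ j hj
  have h3 := (mul_eq_zero.1 h2).resolve_left hJ0
  rw [← h3, ← Matrix.mulVec_mulVec]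
  rfl

end Pullback

end Jets

/-! ### Components of a metric in a chart -/

section Comp

variable {n : ℕ} [NeZero n] {M : Type*} [TopologicalSpace M]
  [ChartedSpace (EuclideanHalfSpace n) M]

lemma uniqueDiffOn_extend_target (e : OpenPartialHomeomorph M (EuclideanHalfSpace n)) :
    UniqueDiffOn ℝ (e.extend (𝓡∂ n)).target := by
  rw [e.extend_target]
  exact (𝓡∂ n).uniqueDiffOn_preimage e.open_target

lemma extend_target_mem_nhdsWithin' {e : OpenPartialHomeomorph M (EuclideanHalfSpace n)}
    {x : EuclideanSpace ℝ (Fin n)} (hx : x ∈ (e.extend (𝓡∂ n)).target) :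
    (e.extend (𝓡∂ n)).target ∈ 𝓝[range (𝓡∂ n)] x := by
  have := e.extend_target_mem_nhdsWithin (I := 𝓡∂ n) (y := (e.extend (𝓡∂ n)).symm x)
    (by simpa using (e.extend (𝓡∂ n)).map_target hx)
  rwa [(e.extend (𝓡∂ n)).right_inv hx] at this

lemma extend_target_eventuallyEq' {e : OpenPartialHomeomorph M (EuclideanHalfSpace n)}
    {x : EuclideanSpace ℝ (Fin n)} (hx : x ∈ (e.extend (𝓡∂ n)).target) :
    (e.extend (𝓡∂ n)).target =ᶠ[𝓝 x] range (𝓡∂ n) := by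
  have := e.extend_target_eventuallyEq (I := 𝓡∂ n) (y := (e.extend (𝓡∂ n)).symm x)
    (by simpa using (e.extend (𝓡∂ n)).map_target hx)
  rwa [(e.extend (𝓡∂ n)).right_inv hx] at this

lemma contMDiffOn_extend_symm_target {k : ℕ∞ω}
    {e : OpenPartialHomeomorph M (EuclideanHalfSpace n)}
    (he : e ∈ IsManifold.maximalAtlas (𝓡∂ n) k M) :
    ContMDiffOn 𝓘(ℝ, EuclideanSpace ℝ (Fin n)) (𝓡∂ n) k (e.extend (𝓡∂ n)).symm
      (e.extend (𝓡∂ n)).target := by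
  rw [e.extend_target']
  exact contMDiffOn_extend_symm he

variable [IsManifold (𝓡∂ n) 1 M]

lemma contMDiffOn_coordVec {m : ℕ} [IsManifold (𝓡∂ n) ((m : ℕ∞ω) + 1) M]
    {e : OpenPartialHomeomorph M (EuclideanHalfSpace n)}
    (he : e ∈ IsManifold.maximalAtlas (𝓡∂ n) ((m : ℕ∞ω) + 1) M) (i : Fin n) :
    ContMDiffOn 𝓘(ℝ, EuclideanSpace ℝ (Fin n)) ((𝓡∂ n).prod 𝓘(ℝ, EuclideanSpace ℝ (Fin n))) m
      (fun x => Bundle.TotalSpace.mk' (EuclideanSpace ℝ (Fin n))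
        (E := fun p : M => TangentSpace (𝓡∂ n) p)
        ((e.extend (𝓡∂ n)).symm x) (coordVec e x i)) (e.extend (𝓡∂ n)).target := by
  set T := (e.extend (𝓡∂ n)).target
  have hT : UniqueMDiffOn 𝓘(ℝ, EuclideanSpace ℝ (Fin n)) T :=
    uniqueMDiffOn_iff_uniqueDiffOn.2 (uniqueDiffOn_extend_target e)
  have h1 := contMDiffOn_extend_symm_target he
  have h2 := h1.contMDiffOn_tangentMapWithin (m := (m : ℕ∞ω)) le_rfl hT
  have h3 : ContMDiffOn 𝓘(ℝ, EuclideanSpace ℝ (Fin n))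
      (𝓘(ℝ, EuclideanSpace ℝ (Fin n)).prod 𝓘(ℝ, EuclideanSpace ℝ (Fin n))) m
      (fun x => (⟨x, EuclideanSpace.single i (1 : ℝ)⟩ :
        TangentBundle 𝓘(ℝ, EuclideanSpace ℝ (Fin n)) (EuclideanSpace ℝ (Fin n)))) T :=
    fun x _ => contMDiffWithinAt_vectorSpace_iff_contDiffWithinAt.2 contDiffWithinAt_const
  refine (h2.comp h3 fun x hx => hx).congr fun x hx => ?_
  simp only [Function.comp, tangentMapWithin, coordVec]
  congr 1
  rw [mfderivWithin_congr_set]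
  exact (extend_target_eventuallyEq' hx).symm

lemma contDiffOn_comp {m : ℕ} [IsManifold (𝓡∂ n) ((m : ℕ∞ω) + 1) M]
    {e : OpenPartialHomeomorph M (EuclideanHalfSpace n)}
    (he : e ∈ IsManifold.maximalAtlas (𝓡∂ n) ((m : ℕ∞ω) + 1) M) (g : Metric n m M) (i j : Fin n) :
    ContDiffOn ℝ m (comp g.inner e i j) (e.extend (𝓡∂ n)).target := by
  have h1 := g.contMDiff.comp_contMDiffOn
    ((contMDiffOn_extend_symm_target he).of_le (le_self_add (b := 1)))
  have h2 := ContMDiffOn.clm_bundle_apply₂ (F₁ := EuclideanSpace ℝ (Fin n))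
    (F₂ := EuclideanSpace ℝ (Fin n)) (F₃ := ℝ) (E₃ := fun _ : M => ℝ)
    h1 (contMDiffOn_coordVec he i) (contMDiffOn_coordVec he j)
  rw [← contMDiffOn_iff_contDiffOn]
  intro x hx
  have h3 := (Bundle.contMDiffWithinAt_totalSpace.1 (h2 x hx)).2
  exact h3

/-- The tensor `k` at `p`, with the tangent space identified with the model space. -/
def tensorAt (k : TensorField n M) (p : M) :
    EuclideanSpace ℝ (Fin n) →L[ℝ] EuclideanSpace ℝ (Fin n) →L[ℝ] ℝ := k p

/-- The transition map between two charts, read in the model vector space. -/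
abbrev transition (e e' : OpenPartialHomeomorph M (EuclideanHalfSpace n)) :
    PartialEquiv (EuclideanSpace ℝ (Fin n)) (EuclideanSpace ℝ (Fin n)) :=
  (𝓡∂ n).extendCoordChange e e'

/-- The differential of the inverse of the chart `e`, as a map between copies of the model space. -/
def chartDiff (e : OpenPartialHomeomorph M (EuclideanHalfSpace n))
    (x : EuclideanSpace ℝ (Fin n)) : EuclideanSpace ℝ (Fin n) →L[ℝ] EuclideanSpace ℝ (Fin n) :=
  mfderivWithin 𝓘(ℝ, EuclideanSpace ℝ (Fin n)) (𝓡∂ n) (e.extend (𝓡∂ n)).symm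
    (range (𝓡∂ n)) x

lemma comp_eq (k : TensorField n M) (e : OpenPartialHomeomorph M (EuclideanHalfSpace n))
    (i j : Fin n) (x : EuclideanSpace ℝ (Fin n)) :
    comp k e i j x = tensorAt k ((e.extend (𝓡∂ n)).symm x)
      (chartDiff e x (EuclideanSpace.single i (1 : ℝ)))
      (chartDiff e x (EuclideanSpace.single j (1 : ℝ))) := rfl

section

variable {e e' : OpenPartialHomeomorph M (EuclideanHalfSpace n)}
  (he : e ∈ IsManifold.maximalAtlas (𝓡∂ n) 1 M) (he' : e' ∈ IsManifold.maximalAtlas (𝓡∂ n) 1 M)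
  {x : EuclideanSpace ℝ (Fin n)}

include he in
lemma hasMFDerivWithinAt_extend_symm (hx : x ∈ (e.extend (𝓡∂ n)).target) :
    HasMFDerivWithinAt 𝓘(ℝ, EuclideanSpace ℝ (Fin n)) (𝓡∂ n) (e.extend (𝓡∂ n)).symm
      (range (𝓡∂ n)) x (chartDiff e x) := by
  have h1 : MDifferentiableWithinAt 𝓘(ℝ, EuclideanSpace ℝ (Fin n)) (𝓡∂ n)
      (e.extend (𝓡∂ n)).symm (range (𝓡∂ n)) x :=
    ((contMDiffOn_extend_symm_target he x hx).mdifferentiableWithinAt (by simp)).mono_of_mem_nhdsWithin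
      (extend_target_mem_nhdsWithin' hx)
  exact h1.hasMFDerivWithinAt

include he he' in
lemma chartDiff_eq (hx : x ∈ (transition e e').source) :
    chartDiff e x = (chartDiff e' (transition e e' x)).comp
      (fderivWithin ℝ (transition e e') (range (𝓡∂ n)) x) := by
  have hx1 : x ∈ (e.extend (𝓡∂ n)).target := hx.1
  have hφ : HasMFDerivWithinAt 𝓘(ℝ, EuclideanSpace ℝ (Fin n)) 𝓘(ℝ, EuclideanSpace ℝ (Fin n))
      (transition e e') (range (𝓡∂ n)) x (fderivWithin ℝ (transition e e') (range (𝓡∂ n)) x) :=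
    (((𝓡∂ n).contDiffWithinAt_extendCoordChange he he' hx).differentiableWithinAt
      (by simp)).hasFDerivWithinAt.hasMFDerivWithinAt
  have h2 := (hasMFDerivWithinAt_extend_symm he' (x := transition e e' x)
    ((transition e e').map_source hx).1).comp x hφ (fun y _ => mem_range_self _)
  have h3 : (e.extend (𝓡∂ n)).symm =ᶠ[𝓝[range (𝓡∂ n)] x]
      (e'.extend (𝓡∂ n)).symm ∘ transition e e' := by
    filter_upwards [(𝓡∂ n).extendCoordChange_source_mem_nhdsWithin hx] with y hy
    exact ((e'.extend (𝓡∂ n)).left_inv hy.2).symm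
  have h4 := h2.congr_of_eventuallyEq h3 ((e'.extend (𝓡∂ n)).left_inv hx.2).symm
  exact h4.mfderivWithin ((𝓡∂ n).uniqueDiffOn.uniqueMDiffOn x
    (e.extend_target_subset_range hx1))

include he in
lemma chartDiff_injective (hx : x ∈ (e.extend (𝓡∂ n)).target) :
    Function.Injective (chartDiff e x) := by
  have h1 := hasMFDerivWithinAt_extend_symm he hx
  have hs : (e.extend (𝓡∂ n)).symm x ∈ e.source := by
    simpa using (e.extend (𝓡∂ n)).map_target hx
  have h2 := ((e.contMDiffAt_extend he hs).mdifferentiableAt (by simp)).hasMFDerivAt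
  have h3 := h2.comp_hasMFDerivWithinAt x h1
  have h4 : id =ᶠ[𝓝[range (𝓡∂ n)] x] (e.extend (𝓡∂ n)) ∘ (e.extend (𝓡∂ n)).symm := by
    filter_upwards [extend_target_mem_nhdsWithin' hx] with y hy
    exact ((e.extend (𝓡∂ n)).right_inv hy).symm
  have h5 := h3.congr_of_eventuallyEq h4 ((e.extend (𝓡∂ n)).right_inv hx).symm
  have hu : UniqueMDiffWithinAt 𝓘(ℝ, EuclideanSpace ℝ (Fin n)) (range (𝓡∂ n)) x :=
    (𝓡∂ n).uniqueDiffOn.uniqueMDiffOn x (e.extend_target_subset_range hx)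
  have h6 := hu.eq h5 (hasMFDerivWithinAt_id _ x)
  intro v w hvw
  have h7 := fun u => DFunLike.congr_fun h6 u
  have hv := h7 v
  have hw := h7 w
  have key : ∀ u, (mfderiv (𝓡∂ n) 𝓘(ℝ, EuclideanSpace ℝ (Fin n)) (e.extend (𝓡∂ n))
    ((e.extend (𝓡∂ n)).symm x)) (chartDiff e x u) = u := h7
  rw [← key v, ← key w, hvw]

end

end Comp

/-! ### The 1-jet of a metric in a chart -/

section JetField

variable {n : ℕ} [NeZero n] {M : Type*} [TopologicalSpace M]
  [ChartedSpace (EuclideanHalfSpace n) M]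

/-- The first-order jet of the components of `k` in the chart `e`. -/
def jet (k : TensorField n M) (e : OpenPartialHomeomorph M (EuclideanHalfSpace n))
    (x : EuclideanSpace ℝ (Fin n)) : Jet n :=
  (fun i j => comp k e i j x, fun c i j =>
    fderivWithin ℝ (comp k e i j) (range (𝓡∂ n)) x (EuclideanSpace.single c (1 : ℝ)))

lemma sffNormSq_eq_jetNormSq (k : TensorField n M) (p : M) :
    sffNormSq k p =
      jetNormSq (jet k (chartAt (EuclideanHalfSpace n) p) (extChartAt (𝓡∂ n) p p)) := rfl

lemma meanCurv_eq_jetMean (k : TensorField n M) (p : M) :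
    meanCurv k p =
      jetMean (jet k (chartAt (EuclideanHalfSpace n) p) (extChartAt (𝓡∂ n) p p)) := rfl

lemma sff_eq_jetSff (k : TensorField n M) (p : M) :
    sff k p = jetSff (jet k (chartAt (EuclideanHalfSpace n) p) (extChartAt (𝓡∂ n) p p)) := rfl

variable [IsManifold (𝓡∂ n) 1 M] {m : ℕ}

lemma eq_sum_single (v : EuclideanSpace ℝ (Fin n)) :
    v = ∑ a, v a • EuclideanSpace.single a (1 : ℝ) := by
  ext i
  simp [Finset.sum_apply, Pi.single_apply]

lemma posDef_jetGram (g : Metric n m M) {e : OpenPartialHomeomorph M (EuclideanHalfSpace n)}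
    (he : e ∈ IsManifold.maximalAtlas (𝓡∂ n) 1 M) {x : EuclideanSpace ℝ (Fin n)}
    (hx : x ∈ (e.extend (𝓡∂ n)).target) : (jetGram (jet g.inner e x)).PosDef := by
  set p := (e.extend (𝓡∂ n)).symm x with hp
  refine Matrix.PosDef.of_dotProduct_mulVec_pos ?_ ?_
  · ext i j
    exact g.symm p _ _
  · intro v hv
    have h1 : (WithLp.toLp 2 v : EuclideanSpace ℝ (Fin n)) ≠ 0 := by
      intro h
      exact hv (congrArg WithLp.ofLp h)
    have h2 : chartDiff e x (WithLp.toLp 2 v) ≠ 0 := fun h =>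
      h1 ((injective_iff_map_eq_zero _).1 (chartDiff_injective he hx) _ h)
    have h3 : 0 < tensorAt g.inner p (chartDiff e x (WithLp.toLp 2 v))
        (chartDiff e x (WithLp.toLp 2 v)) := g.pos p _ h2
    rw [eq_sum_single (WithLp.toLp 2 v : EuclideanSpace ℝ (Fin n))] at h3
    simp only [map_sum, map_smul, sum_apply, smul_apply,
      smul_eq_mul] at h3
    refine h3.trans_eq ?_
    unfold Matrix.mulVec dotProduct
    simp only [Finset.mul_sum, Pi.star_apply, star_trivial, jetGram, jet,
      Matrix.of_apply, comp_eq]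
    rw [Finset.sum_comm]
    refine Finset.sum_congr rfl fun a _ => Finset.sum_congr rfl fun b _ => by ring

/-! ### Transition maps -/

/-- The Jacobian matrix of a map between coordinate spaces, within the half-space. -/
def jac (φ : EuclideanSpace ℝ (Fin n) → EuclideanSpace ℝ (Fin n))
    (x : EuclideanSpace ℝ (Fin n)) : Matrix (Fin n) (Fin n) ℝ :=
  Matrix.of fun a i => fderivWithin ℝ φ (range (𝓡∂ n)) x (EuclideanSpace.single i (1 : ℝ)) a

/-- The second derivatives of a map between coordinate spaces, within the half-space. -/
def hess (φ : EuclideanSpace ℝ (Fin n) → EuclideanSpace ℝ (Fin n))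
    (x : EuclideanSpace ℝ (Fin n)) (a c i : Fin n) : ℝ :=
  fderivWithin ℝ (fderivWithin ℝ φ (range (𝓡∂ n))) (range (𝓡∂ n)) x
    (EuclideanSpace.single c (1 : ℝ)) (EuclideanSpace.single i (1 : ℝ)) a

lemma comp_eq_sum {e e' : OpenPartialHomeomorph M (EuclideanHalfSpace n)}
    (he : e ∈ IsManifold.maximalAtlas (𝓡∂ n) 1 M) (he' : e' ∈ IsManifold.maximalAtlas (𝓡∂ n) 1 M)
    (k : TensorField n M)
    {x : EuclideanSpace ℝ (Fin n)} (hx : x ∈ (transition e e').source) (i j : Fin n) :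
    comp k e i j x = ∑ a, ∑ b, jac (transition e e') x a i * jac (transition e e') x b j *
      comp k e' a b (transition e e' x) := by
  have h1 : (e.extend (𝓡∂ n)).symm x = (e'.extend (𝓡∂ n)).symm (transition e e' x) :=
    ((e'.extend (𝓡∂ n)).left_inv hx.2).symm
  have h2 : ∀ i, chartDiff e x (EuclideanSpace.single i (1 : ℝ)) =
      ∑ a, jac (transition e e') x a i •
        chartDiff e' (transition e e' x) (EuclideanSpace.single a (1 : ℝ)) := by
    intro i
    rw [chartDiff_eq he he' hx, ContinuousLinearMap.comp_apply]
    conv_lhs => rw [eq_sum_single (fderivWithin ℝ _ _ _ _)]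
    simp only [map_sum, map_smul]
    rfl
  rw [comp_eq, h1, h2, h2]
  simp only [map_sum, map_smul, sum_apply, smul_apply,
    smul_eq_mul, Finset.mul_sum, comp_eq]
  rw [Finset.sum_comm]
  refine Finset.sum_congr rfl fun a _ => Finset.sum_congr rfl fun b _ => by ring

variable [IsManifold (𝓡∂ n) ((m : ℕ∞ω) + 1) M]

lemma mem_maximalAtlas_one {e : OpenPartialHomeomorph M (EuclideanHalfSpace n)}
    (he : e ∈ IsManifold.maximalAtlas (𝓡∂ n) ((m : ℕ∞ω) + 1) M) :
    e ∈ IsManifold.maximalAtlas (𝓡∂ n) 1 M :=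
  IsManifold.maximalAtlas_subset_of_le le_add_self he

section

variable {e e' : OpenPartialHomeomorph M (EuclideanHalfSpace n)}
    (he : e ∈ IsManifold.maximalAtlas (𝓡∂ n) ((m : ℕ∞ω) + 1) M)
    (he' : e' ∈ IsManifold.maximalAtlas (𝓡∂ n) ((m : ℕ∞ω) + 1) M)
    {x : EuclideanSpace ℝ (Fin n)}
include he he'

lemma contDiffWithinAt_transition (hx : x ∈ (transition e e').source) :
    ContDiffWithinAt ℝ ((m : ℕ∞ω) + 1) (transition e e') (range (𝓡∂ n)) x :=
  (𝓡∂ n).contDiffWithinAt_extendCoordChange he he' hx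

lemma differentiableWithinAt_fderivWithin_transition (hm : 1 ≤ m)
    (hx : x ∈ (transition e e').source) :
    DifferentiableWithinAt ℝ (fderivWithin ℝ (transition e e') (range (𝓡∂ n)))
      (range (𝓡∂ n)) x := by
  have h1 := (contDiffWithinAt_transition he he' hx).fderivWithin_right (m := (m : ℕ∞ω))
    (𝓡∂ n).uniqueDiffOn le_rfl (e.extend_target_subset_range hx.1)
  exact h1.differentiableWithinAt (by exact_mod_cast (by omega : m ≠ 0))

lemma jet_eq_jetPullback (hm : 1 ≤ m) (g : Metric n m M) (hx : x ∈ (transition e e').source) :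
    jet g.inner e x = jetPullback (jac (transition e e') x) (hess (transition e e') x)
      (jet g.inner e' (transition e e' x)) := by
  have he1 := mem_maximalAtlas_one he
  have he1' := mem_maximalAtlas_one he'
  have hxr : x ∈ range (𝓡∂ n) := e.extend_target_subset_range hx.1
  have hu : UniqueDiffWithinAt ℝ (range (𝓡∂ n)) x := (𝓡∂ n).uniqueDiffOn x hxr
  have hx' : transition e e' x ∈ (e'.extend (𝓡∂ n)).target := ((transition e e').map_source hx).1
  refine Prod.ext ?_ ?_
  · ext i j
    exact comp_eq_sum he1 he1' g.inner hx i j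
  · ext c i j
    have hφ : HasFDerivWithinAt (transition e e')
        (fderivWithin ℝ (transition e e') (range (𝓡∂ n)) x) (range (𝓡∂ n)) x :=
      ((contDiffWithinAt_transition he he' hx).differentiableWithinAt
        (by simp)).hasFDerivWithinAt
    have hD := (differentiableWithinAt_fderivWithin_transition he he' hm hx).hasFDerivWithinAt
    have hJ : ∀ a i, HasFDerivWithinAt (fun y => jac (transition e e') y a i)
        ((EuclideanSpace.proj a : EuclideanSpace ℝ (Fin n) →L[ℝ] ℝ).comp
          ((ContinuousLinearMap.apply ℝ (EuclideanSpace ℝ (Fin n))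
            (EuclideanSpace.single i (1 : ℝ))).comp
          (fderivWithin ℝ (fderivWithin ℝ (transition e e') (range (𝓡∂ n))) (range (𝓡∂ n)) x)))
        (range (𝓡∂ n)) x := fun a i =>
      (EuclideanSpace.proj a : EuclideanSpace ℝ (Fin n) →L[ℝ] ℝ).hasFDerivAt.comp_hasFDerivWithinAt
        x ((ContinuousLinearMap.apply ℝ (EuclideanSpace ℝ (Fin n))
            (EuclideanSpace.single i (1 : ℝ))).hasFDerivAt.comp_hasFDerivWithinAt x hD)
    have hg : ∀ a b, HasFDerivWithinAt (comp g.inner e' a b)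
        (fderivWithin ℝ (comp g.inner e' a b) (range (𝓡∂ n)) (transition e e' x))
        (range (𝓡∂ n)) (transition e e' x) := fun a b =>
      (((contDiffOn_comp he' g a b _ hx').differentiableWithinAt
        (by exact_mod_cast (by omega : m ≠ 0))).mono_of_mem_nhdsWithin
        (extend_target_mem_nhdsWithin' hx')).hasFDerivWithinAt
    have hg' := fun a b => (hg a b).comp x hφ (fun y _ => mem_range_self _)
    have hsum := HasFDerivWithinAt.fun_sum (u := Finset.univ) fun a _ =>
      HasFDerivWithinAt.fun_sum (u := Finset.univ) fun b _ =>
        ((hJ a i).mul (hJ b j)).mul (hg' a b)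
    have hev : comp g.inner e i j =ᶠ[𝓝[range (𝓡∂ n)] x] fun y => ∑ a, ∑ b,
        jac (transition e e') y a i * jac (transition e e') y b j *
          comp g.inner e' a b (transition e e' y) := by
      filter_upwards [(𝓡∂ n).extendCoordChange_source_mem_nhdsWithin hx] with y hy
      exact comp_eq_sum he1 he1' g.inner hy i j
    have hfin := (hsum.congr_of_eventuallyEq hev (comp_eq_sum he1 he1' g.inner hx i j)).fderivWithin hu
    change fderivWithin ℝ (comp g.inner e i j) (range (𝓡∂ n)) x (EuclideanSpace.single c (1 : ℝ)) = _
    rw [hfin]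
    simp only [sum_apply, jetPullback]
    refine Finset.sum_congr rfl fun a _ => Finset.sum_congr rfl fun b _ => ?_
    have hlast : fderivWithin ℝ (comp g.inner e' a b) (range (𝓡∂ n)) (transition e e' x)
        (fderivWithin ℝ (transition e e') (range (𝓡∂ n)) x (EuclideanSpace.single c (1 : ℝ))) =
        ∑ d, jac (transition e e') x d c * (jet g.inner e' (transition e e' x)).2 d a b := by
      conv_lhs => rw [eq_sum_single (fderivWithin ℝ (transition e e') _ _ _)]
      simp only [map_sum, map_smul, smul_eq_mul]
      rfl
    simp only [add_apply, smul_apply,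
      ContinuousLinearMap.comp_apply, hlast, smul_eq_mul]
    have hproj : ∀ (a : Fin n) (v : EuclideanSpace ℝ (Fin n)),
      (EuclideanSpace.proj a : EuclideanSpace ℝ (Fin n) →L[ℝ] ℝ) v = v a := fun _ _ => rfl
    simp only [hess, jac, jet, Matrix.of_apply, hproj, Pi.mul_apply,
      ContinuousLinearMap.apply_apply, Function.comp]
    ring

end

end JetField

/-! ### The boundary in a chart -/

section Incl

variable {n : ℕ} [NeZero n]

/-- The inclusion of the boundary of the half-space, as a continuous linear map. -/
def inclL (n : ℕ) [NeZero n] : EuclideanSpace ℝ (TIdx n) →L[ℝ] EuclideanSpace ℝ (Fin n) :=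
  LinearMap.toContinuousLinearMap
    { toFun := inclBdry
      map_add' := fun x y => by
        ext i
        by_cases hi : i = 0 <;> simp [inclBdry, hi]
      map_smul' := fun c x => by
        ext i
        by_cases hi : i = 0 <;> simp [inclBdry, hi] }

/-- The tangential projection, as a continuous linear map. -/
def tangL (n : ℕ) [NeZero n] : EuclideanSpace ℝ (Fin n) →L[ℝ] EuclideanSpace ℝ (TIdx n) :=
  LinearMap.toContinuousLinearMap
    { toFun := tangPart
      map_add' := fun x y => by ext i; simp [tangPart]
      map_smul' := fun c x => by ext i; simp [tangPart] }

@[simp] lemma inclL_apply (y : EuclideanSpace ℝ (TIdx n)) : inclL n y = inclBdry y := rfl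

lemma continuous_inclBdry : Continuous (inclBdry (n := n)) := (inclL n).continuous

lemma contDiff_inclBdry {k : ℕ∞ω} : ContDiff ℝ k (inclBdry (n := n)) := (inclL n).contDiff

@[simp] lemma inclBdry_zero (y : EuclideanSpace ℝ (TIdx n)) : inclBdry y 0 = 0 := by
  simp [inclBdry]

@[simp] lemma tangPart_inclBdry (y : EuclideanSpace ℝ (TIdx n)) : tangPart (inclBdry y) = y := by
  ext i; simp [tangPart, inclBdry, i.2]

lemma inclBdry_tangPart {x : EuclideanSpace ℝ (Fin n)} (hx : x 0 = 0) :
    inclBdry (tangPart x) = x := by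
  ext i
  by_cases hi : i = 0
  · subst hi; simp [hx]
  · simp [inclBdry, tangPart, hi]

lemma inclBdry_single (i : TIdx n) :
    inclBdry (EuclideanSpace.single i (1 : ℝ)) = EuclideanSpace.single i.1 (1 : ℝ) := by
  ext j
  by_cases hj : j = 0
  · subst hj
    simp [i.2.symm]
  · simp [inclBdry, hj, Subtype.ext_iff]

lemma inclBdry_mem_range (y : EuclideanSpace ℝ (TIdx n)) : inclBdry y ∈ range (𝓡∂ n) := by
  rw [range_modelWithCornersEuclideanHalfSpace]
  simp

lemma tendsto_inclBdry (y : EuclideanSpace ℝ (TIdx n)) :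
    Tendsto inclBdry (𝓝 y) (𝓝[range (𝓡∂ n)] (inclBdry y)) :=
  tendsto_nhdsWithin_iff.2
    ⟨continuous_inclBdry.continuousAt, Eventually.of_forall inclBdry_mem_range⟩

end Incl

section Boundary

variable {n : ℕ} [NeZero n] {M : Type*} [TopologicalSpace M]
  [ChartedSpace (EuclideanHalfSpace n) M]

section

variable {e e' : OpenPartialHomeomorph M (EuclideanHalfSpace n)}

lemma extend_mem_transition_source {p : M} (hp : p ∈ e.source) (hp' : p ∈ e'.source) :
    e.extend (𝓡∂ n) p ∈ (transition e e').source := by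
  rw [← OpenPartialHomeomorph.extend_image_source_inter]
  exact mem_image_of_mem _ ⟨hp, hp'⟩

lemma transition_extend {p : M} (hp : p ∈ e.source) :
    transition e e' (e.extend (𝓡∂ n) p) = e'.extend (𝓡∂ n) p := by
  change e'.extend (𝓡∂ n) ((e.extend (𝓡∂ n)).symm (e.extend (𝓡∂ n) p)) = _
  rw [e.extend_left_inv hp]

/-- Interior points of the half-space stay interior under transition maps: these have surjective
differentials. -/
lemma transition_zero_pos (he : e ∈ IsManifold.maximalAtlas (𝓡∂ n) 1 M)
    (he' : e' ∈ IsManifold.maximalAtlas (𝓡∂ n) 1 M) {x : EuclideanSpace ℝ (Fin n)}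
    (hx : x ∈ (transition e e').source) (h0 : 0 < x 0) : 0 < transition e e' x 0 := by
  have hr : range (𝓡∂ n) ∈ 𝓝 x := by
    rw [← mem_interior_iff_mem_nhds, interior_range_modelWithCornersEuclideanHalfSpace]
    exact h0
  have hs : (transition e e').source ∈ 𝓝 x := by
    rw [← nhdsWithin_eq_nhds.2 hr]
    exact (𝓡∂ n).extendCoordChange_source_mem_nhdsWithin hx
  have hd : DifferentiableAt ℝ (transition e e') x :=
    ((𝓡∂ n).contDiffWithinAt_extendCoordChange he he' hx).contDiffAt hr |>.differentiableAt
      (by simp)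
  have hinv := (𝓡∂ n).isInvertible_fderivWithin_extendCoordChange one_ne_zero he he' hx
  rw [fderivWithin_of_mem_nhds hs] at hinv
  have := hd.mem_interior_convex_of_surjective_fderiv hr (s := range (𝓡∂ n)) (𝓡∂ n).convex_range
    (𝓡∂ n).isClosed_range (𝓡∂ n).nonempty_interior (fun y _ => mem_range_self _) hinv.surjective
  rwa [interior_range_modelWithCornersEuclideanHalfSpace] at this

lemma transition_zero_eq_zero (he : e ∈ IsManifold.maximalAtlas (𝓡∂ n) 1 M)
    (he' : e' ∈ IsManifold.maximalAtlas (𝓡∂ n) 1 M) {x : EuclideanSpace ℝ (Fin n)}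
    (hx : x ∈ (transition e e').source) (h0 : x 0 = 0) : transition e e' x 0 = 0 := by
  have h1 : transition e e' x ∈ range (𝓡∂ n) := mem_range_self _
  rw [range_modelWithCornersEuclideanHalfSpace] at h1
  have h2 : 0 ≤ transition e e' x 0 := h1
  refine le_antisymm (not_lt.1 fun h3 => ?_) h2
  have h4 := transition_zero_pos he' he ((transition e e').map_source hx) h3
  have h5 : transition e' e (transition e e' x) = x := (transition e e').left_inv hx
  rw [h5, h0] at h4
  exact lt_irrefl _ h4

lemma mem_boundary_iff [IsManifold (𝓡∂ n) 1 M] (he : e ∈ IsManifold.maximalAtlas (𝓡∂ n) 1 M)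
    {p : M} (hp : p ∈ e.source) :
    p ∈ (𝓡∂ n).boundary M ↔ e.extend (𝓡∂ n) p 0 = 0 := by
  have hc := IsManifold.chart_mem_maximalAtlas (I := 𝓡∂ n) (n := 1) p
  have h1 : p ∈ (𝓡∂ n).boundary M ↔ extChartAt (𝓡∂ n) p p 0 = 0 := by
    change (𝓡∂ n).IsBoundaryPoint p ↔ _
    rw [ModelWithCorners.isBoundaryPoint_iff, frontier_range_modelWithCornersEuclideanHalfSpace]
    exact eq_comm
  have hps := mem_chart_source (EuclideanHalfSpace n) p
  rw [h1]
  constructor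
  · intro h
    rw [← transition_extend (e' := e) hps]
    exact transition_zero_eq_zero hc he (extend_mem_transition_source hps hp) h
  · intro h
    have := transition_zero_eq_zero he hc (extend_mem_transition_source hp hps) h
    rwa [transition_extend hp] at this

end

variable [IsManifold (𝓡∂ n) 1 M] {m : ℕ} [IsManifold (𝓡∂ n) ((m : ℕ∞ω) + 1) M]

section

variable {e e' : OpenPartialHomeomorph M (EuclideanHalfSpace n)}
    (he : e ∈ IsManifold.maximalAtlas (𝓡∂ n) ((m : ℕ∞ω) + 1) M)
    (he' : e' ∈ IsManifold.maximalAtlas (𝓡∂ n) ((m : ℕ∞ω) + 1) M)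
    {x : EuclideanSpace ℝ (Fin n)}
include he he'

/-- On the boundary, the tangential derivatives of the normal component of a transition map
vanish. -/
lemma fderivWithin_transition_incl_zero {y : EuclideanSpace ℝ (TIdx n)}
    (hy : inclBdry y ∈ (transition e e').source) (v : EuclideanSpace ℝ (TIdx n)) :
    fderivWithin ℝ (transition e e') (range (𝓡∂ n)) (inclBdry y) (inclBdry v) 0 = 0 := by
  have hφ : HasFDerivWithinAt (transition e e')
      (fderivWithin ℝ (transition e e') (range (𝓡∂ n)) (inclBdry y)) (range (𝓡∂ n))
      (inclBdry y) :=
    ((contDiffWithinAt_transition he he' hy).differentiableWithinAt (by simp)).hasFDerivWithinAt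
  have h1 := hφ.comp_hasFDerivAt y (inclL n).hasFDerivAt (Eventually.of_forall inclBdry_mem_range)
  have h2 := (EuclideanSpace.proj 0 : EuclideanSpace ℝ (Fin n) →L[ℝ] ℝ).hasFDerivAt.comp y h1
  have h3 : (fun _ => (0 : ℝ)) =ᶠ[𝓝 y]
      (EuclideanSpace.proj 0 : EuclideanSpace ℝ (Fin n) →L[ℝ] ℝ) ∘
        (transition e e') ∘ (inclL n) := by
    filter_upwards [(tendsto_inclBdry y).eventually
      ((𝓡∂ n).extendCoordChange_source_mem_nhdsWithin hy)] with z hz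
    exact (transition_zero_eq_zero (mem_maximalAtlas_one he) (mem_maximalAtlas_one he') hz
      (inclBdry_zero z)).symm
  have h4 := (hasFDerivAt_const (0 : ℝ) y).unique (h2.congr_of_eventuallyEq h3)
  exact (DFunLike.congr_fun h4 v).symm

lemma jac_transition_zero (hx : x ∈ (transition e e').source) (h0 : x 0 = 0) {i : Fin n}
    (hi : i ≠ 0) : jac (transition e e') x 0 i = 0 := by
  rw [← inclBdry_tangPart h0] at hx ⊢
  have := fderivWithin_transition_incl_zero he he' hx (EuclideanSpace.single ⟨i, hi⟩ 1)
  rwa [inclBdry_single] at this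

lemma hess_transition_zero (hm : 1 ≤ m) (hx : x ∈ (transition e e').source) (h0 : x 0 = 0)
    {i j : Fin n} (hi : i ≠ 0) (hj : j ≠ 0) : hess (transition e e') x 0 i j = 0 := by
  rw [← inclBdry_tangPart h0] at hx ⊢
  set y := tangPart x
  have hD := (differentiableWithinAt_fderivWithin_transition he he' hm hx).hasFDerivWithinAt
  have h1 := hD.comp_hasFDerivAt y (inclL n).hasFDerivAt (Eventually.of_forall inclBdry_mem_range)
  have h2 := (EuclideanSpace.proj 0 : EuclideanSpace ℝ (Fin n) →L[ℝ] ℝ).hasFDerivAt.comp y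
    (((ContinuousLinearMap.apply ℝ (EuclideanSpace ℝ (Fin n)))
      (EuclideanSpace.single j (1 : ℝ))).hasFDerivAt.comp y h1)
  have h3 : (fun _ => (0 : ℝ)) =ᶠ[𝓝 y]
      (EuclideanSpace.proj 0 : EuclideanSpace ℝ (Fin n) →L[ℝ] ℝ) ∘
        ((ContinuousLinearMap.apply ℝ (EuclideanSpace ℝ (Fin n)))
          (EuclideanSpace.single j (1 : ℝ))) ∘
        (fderivWithin ℝ (transition e e') (range (𝓡∂ n))) ∘ (inclL n) := by
    filter_upwards [(tendsto_inclBdry y).eventually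
      ((𝓡∂ n).extendCoordChange_source_mem_nhdsWithin hx)] with z hz
    have := fderivWithin_transition_incl_zero he he' hz (EuclideanSpace.single ⟨j, hj⟩ 1)
    rw [inclBdry_single] at this
    exact this.symm
  have h4 := (hasFDerivAt_const (0 : ℝ) y).unique (h2.congr_of_eventuallyEq h3)
  have h5 := (DFunLike.congr_fun h4 (EuclideanSpace.single ⟨i, hi⟩ 1)).symm
  simp only [ContinuousLinearMap.comp_apply, inclL_apply, inclBdry_single] at h5
  exact h5

lemma hess_transition_symm (hm : 1 ≤ m) (hx : x ∈ (transition e e').source) (a c i : Fin n) :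
    hess (transition e e') x a c i = hess (transition e e') x a i c := by
  have hxr : x ∈ range (𝓡∂ n) := e.extend_target_subset_range hx.1
  have h2 : ContDiffWithinAt ℝ 2 (transition e e') (range (𝓡∂ n)) x := by
    refine (contDiffWithinAt_transition he he' hx).of_le ?_
    have : ((1 + 1 : ℕ) : ℕ∞ω) ≤ ((m + 1 : ℕ) : ℕ∞ω) := by exact_mod_cast (by omega)
    simpa [one_add_one_eq_two] using this
  have hs := h2.isSymmSndFDerivWithinAt (by simp) (𝓡∂ n).uniqueDiffOn
    ((𝓡∂ n).range_subset_closure_interior hxr) hxr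
  exact congrArg (fun v : EuclideanSpace ℝ (Fin n) => v a) (hs _ _)

/-- The squared norm of the second fundamental form does not depend on the chart. -/
lemma jetNormSq_jet_eq (hm : 1 ≤ m) (g : Metric n m M) (hx : x ∈ (transition e e').source)
    (h0 : x 0 = 0) :
    jetNormSq (jet g.inner e x) = jetNormSq (jet g.inner e' (transition e e' x)) := by
  have hw := posDef_jetGram g (mem_maximalAtlas_one he') ((transition e e').map_source hx).1
  have hw' := posDef_jetGram g (mem_maximalAtlas_one he) hx.1
  rw [jet_eq_jetPullback he he' hm g hx] at hw' ⊢
  exact jetNormSq_jetPullback (fun i hi => jac_transition_zero he he' hx h0 hi) hw hw'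
    (hess_transition_symm he he' hm hx)
    (fun i j hi hj => hess_transition_zero he he' hm hx h0 hi hj)

end

lemma sffNormSq_eq (hm : 1 ≤ m) (g : Metric n m M)
    {e : OpenPartialHomeomorph M (EuclideanHalfSpace n)}
    (he : e ∈ IsManifold.maximalAtlas (𝓡∂ n) ((m : ℕ∞ω) + 1) M) {p : M}
    (hp : p ∈ (𝓡∂ n).boundary M) (hpe : p ∈ e.source) :
    sffNormSq g.inner p = jetNormSq (jet g.inner e (e.extend (𝓡∂ n) p)) := by
  have hc := IsManifold.chart_mem_maximalAtlas (I := 𝓡∂ n) (n := (m : ℕ∞ω) + 1) p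
  have hps := mem_chart_source (EuclideanHalfSpace n) p
  rw [sffNormSq_eq_jetNormSq]
  have h0 := (mem_boundary_iff (mem_maximalAtlas_one hc) hps).1 hp
  have := jetNormSq_jet_eq hc he hm g (extend_mem_transition_source hps hpe) h0
  rwa [transition_extend hps] at this

/-! ### The squared norm of the second fundamental form in a chart of the boundary -/

/-- The squared norm of the second fundamental form, as a function of the coordinates of the
boundary in the chart `e`. -/
def chartFun (k : TensorField n M) (e : OpenPartialHomeomorph M (EuclideanHalfSpace n))
    (y : EuclideanSpace ℝ (TIdx n)) : ℝ :=
  jetNormSq (jet k e (inclBdry y))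

lemma contDiffWithinAt_jet {e : OpenPartialHomeomorph M (EuclideanHalfSpace n)}
    (he : e ∈ IsManifold.maximalAtlas (𝓡∂ n) ((m : ℕ∞ω) + 1) M) (hm : 3 ≤ m) (g : Metric n m M)
    {x : EuclideanSpace ℝ (Fin n)} (hx : x ∈ (e.extend (𝓡∂ n)).target) :
    ContDiffWithinAt ℝ 2 (jet g.inner e) (range (𝓡∂ n)) x := by
  have h1 : ∀ i j, ContDiffWithinAt ℝ 3 (comp g.inner e i j) (range (𝓡∂ n)) x := fun i j =>
    ((contDiffOn_comp he g i j x hx).mono_of_mem_nhdsWithin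
      (extend_target_mem_nhdsWithin' hx)).of_le (by exact_mod_cast hm)
  have hxr := e.extend_target_subset_range hx
  refine ContDiffWithinAt.prodMk ?_ ?_
  · refine contDiffWithinAt_pi.2 fun i => contDiffWithinAt_pi.2 fun j => (h1 i j).of_le ?_
    norm_num
  · refine contDiffWithinAt_pi.2 fun c => contDiffWithinAt_pi.2 fun i =>
      contDiffWithinAt_pi.2 fun j => ?_
    exact ((h1 i j).fderivWithin_right (m := 2) (𝓡∂ n).uniqueDiffOn (by norm_num) hxr).clm_apply
      contDiffWithinAt_const

lemma contDiffAt_jet_inclBdry {e : OpenPartialHomeomorph M (EuclideanHalfSpace n)}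
    (he : e ∈ IsManifold.maximalAtlas (𝓡∂ n) ((m : ℕ∞ω) + 1) M) (hm : 3 ≤ m) (g : Metric n m M)
    {y : EuclideanSpace ℝ (TIdx n)} (hy : inclBdry y ∈ (e.extend (𝓡∂ n)).target) :
    ContDiffAt ℝ 2 (fun y => jet g.inner e (inclBdry y)) y :=
  (contDiffWithinAt_jet he hm g hy).comp y contDiff_inclBdry.contDiffAt
    (s := univ) (fun z _ => inclBdry_mem_range z)

lemma contDiffAt_chartFun {e : OpenPartialHomeomorph M (EuclideanHalfSpace n)}
    (he : e ∈ IsManifold.maximalAtlas (𝓡∂ n) ((m : ℕ∞ω) + 1) M) (hm : 3 ≤ m) (g : Metric n m M)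
    {y : EuclideanSpace ℝ (TIdx n)} (hy : inclBdry y ∈ (e.extend (𝓡∂ n)).target) :
    ContDiffAt ℝ 2 (chartFun g.inner e) y :=
  (contDiffAt_jetNormSq (posDef_jetGram g (mem_maximalAtlas_one he) hy)).comp y
    (contDiffAt_jet_inclBdry he hm g hy)

/-- The transition map between two charts of the boundary. -/
def bdryTransition (e e' : OpenPartialHomeomorph M (EuclideanHalfSpace n))
    (y : EuclideanSpace ℝ (TIdx n)) : EuclideanSpace ℝ (TIdx n) :=
  tangPart (transition e e' (inclBdry y))

section

variable {e e' : OpenPartialHomeomorph M (EuclideanHalfSpace n)}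
    (he : e ∈ IsManifold.maximalAtlas (𝓡∂ n) ((m : ℕ∞ω) + 1) M)
    (he' : e' ∈ IsManifold.maximalAtlas (𝓡∂ n) ((m : ℕ∞ω) + 1) M)
    {y : EuclideanSpace ℝ (TIdx n)} (hy : inclBdry y ∈ (transition e e').source)
include he he' hy

lemma inclBdry_bdryTransition :
    inclBdry (bdryTransition e e' y) = transition e e' (inclBdry y) :=
  inclBdry_tangPart (transition_zero_eq_zero (mem_maximalAtlas_one he) (mem_maximalAtlas_one he')
    hy (inclBdry_zero y))

lemma bdryTransition_bdryTransition : bdryTransition e' e (bdryTransition e e' y) = y := by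
  rw [bdryTransition, inclBdry_bdryTransition he he' hy]
  have h5 : transition e' e (transition e e' (inclBdry y)) = inclBdry y :=
    (transition e e').left_inv hy
  rw [h5, tangPart_inclBdry]

lemma inclBdry_bdryTransition_mem :
    inclBdry (bdryTransition e e' y) ∈ (transition e' e).source := by
  rw [inclBdry_bdryTransition he he' hy]
  exact (transition e e').map_source hy

lemma contDiffAt_bdryTransition (hm : 1 ≤ m) : ContDiffAt ℝ 2 (bdryTransition e e') y := by
  have h2 : ContDiffWithinAt ℝ 2 (transition e e') (range (𝓡∂ n)) (inclBdry y) := by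
    refine (contDiffWithinAt_transition he he' hy).of_le ?_
    have : ((1 + 1 : ℕ) : ℕ∞ω) ≤ ((m + 1 : ℕ) : ℕ∞ω) := by exact_mod_cast (by omega)
    simpa [one_add_one_eq_two] using this
  exact (tangL n).contDiff.contDiffAt.comp y (h2.comp y contDiff_inclBdry.contDiffAt
    (s := univ) (fun z _ => inclBdry_mem_range z))

lemma bijective_fderiv_bdryTransition (hm : 1 ≤ m) :
    Function.Bijective (fderiv ℝ (bdryTransition e e') y) := by
  have h1 := (contDiffAt_bdryTransition he he' hy hm).differentiableAt (by simp)
  have h2 := (contDiffAt_bdryTransition he' he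
    (inclBdry_bdryTransition_mem he he' hy) hm).differentiableAt (by simp)
  have h3 := h2.hasFDerivAt.comp y h1.hasFDerivAt
  have h4 : id =ᶠ[𝓝 y] bdryTransition e' e ∘ bdryTransition e e' := by
    filter_upwards [(tendsto_inclBdry y).eventually
      ((𝓡∂ n).extendCoordChange_source_mem_nhdsWithin hy)] with z hz
    exact (bdryTransition_bdryTransition he he' hz).symm
  have h5 := (hasFDerivAt_id y).unique (h3.congr_of_eventuallyEq h4)
  have hinj : Function.Injective (fderiv ℝ (bdryTransition e e') y) := by
    intro v w hvw
    have hv := DFunLike.congr_fun h5 v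
    have hw := DFunLike.congr_fun h5 w
    simp only [ContinuousLinearMap.comp_apply] at hv hw
    rw [← hvw] at hw
    exact hv.trans hw.symm
  exact ⟨hinj, (LinearMap.injective_iff_surjective (f := (fderiv ℝ (bdryTransition e e') y :
    EuclideanSpace ℝ (TIdx n) →ₗ[ℝ] EuclideanSpace ℝ (TIdx n)))).1 hinj⟩

lemma chartFun_eventuallyEq (hm : 1 ≤ m) (g : Metric n m M) :
    chartFun g.inner e =ᶠ[𝓝 y] fun z => chartFun g.inner e' (bdryTransition e e' z) := by
  filter_upwards [(tendsto_inclBdry y).eventually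
      ((𝓡∂ n).extendCoordChange_source_mem_nhdsWithin hy)] with z hz
  rw [chartFun, chartFun, inclBdry_bdryTransition he he' hz]
  exact jetNormSq_jet_eq he he' hm g hz (inclBdry_zero z)

/-- Non-degeneracy of critical points on the boundary does not depend on the chart. -/
lemma NondegAt.chartFun_of_transition (hm : 3 ≤ m) (g : Metric n m M)
    (h : NondegAt (chartFun g.inner e') (bdryTransition e e' y)) :
    NondegAt (chartFun g.inner e) y := by
  refine NondegAt.congr ?_ (chartFun_eventuallyEq he he' hy (by omega) g)
  refine h.comp ?_ (contDiffAt_bdryTransition he he' hy (by omega))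
    (bijective_fderiv_bdryTransition he he' hy (by omega))
  exact contDiffAt_chartFun he' hm g (inclBdry_bdryTransition_mem he he' hy).1

end

lemma chartFun_eq_sffNormSq (hm : 1 ≤ m) (g : Metric n m M)
    {e : OpenPartialHomeomorph M (EuclideanHalfSpace n)}
    (he : e ∈ IsManifold.maximalAtlas (𝓡∂ n) ((m : ℕ∞ω) + 1) M) {y : EuclideanSpace ℝ (TIdx n)}
    (hy : inclBdry y ∈ (e.extend (𝓡∂ n)).target) :
    (e.extend (𝓡∂ n)).symm (inclBdry y) ∈ (𝓡∂ n).boundary M ∧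
      chartFun g.inner e y = sffNormSq g.inner ((e.extend (𝓡∂ n)).symm (inclBdry y)) := by
  have hq : (e.extend (𝓡∂ n)).symm (inclBdry y) ∈ e.source := by
    simpa using (e.extend (𝓡∂ n)).map_target hy
  have hz' := (e.extend (𝓡∂ n)).right_inv hy
  have hqb : (e.extend (𝓡∂ n)).symm (inclBdry y) ∈ (𝓡∂ n).boundary M := by
    rw [mem_boundary_iff (mem_maximalAtlas_one he) hq, hz', inclBdry_zero]
  refine ⟨hqb, ?_⟩
  rw [sffNormSq_eq hm g he hqb hq, hz']
  rfl

lemma bdryRead_eventuallyEq (hm : 1 ≤ m) (g : Metric n m M) {p : M}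
    (hp : p ∈ (𝓡∂ n).boundary M) :
    bdryRead (n := n) (sffNormSq g.inner) p =ᶠ[𝓝 (tangPart (extChartAt (𝓡∂ n) p p))]
      chartFun g.inner (chartAt (EuclideanHalfSpace n) p) := by
  set e := chartAt (EuclideanHalfSpace n) p
  have he := IsManifold.chart_mem_maximalAtlas (I := 𝓡∂ n) (n := (m : ℕ∞ω) + 1) p
  have hps := mem_chart_source (EuclideanHalfSpace n) p
  have h0 : extChartAt (𝓡∂ n) p p 0 = 0 := (mem_boundary_iff (mem_maximalAtlas_one he) hps).1 hp
  have hT : (e.extend (𝓡∂ n)).target ∈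
      𝓝[range (𝓡∂ n)] (inclBdry (tangPart (extChartAt (𝓡∂ n) p p))) := by
    rw [inclBdry_tangPart h0]
    exact e.extend_target_mem_nhdsWithin hps
  filter_upwards [(tendsto_inclBdry _).eventually hT] with z hz
  exact (chartFun_eq_sffNormSq hm g he hz).2.symm

/-- The Morse condition at a boundary point `p`, in the preferred chart at `p`. -/
def NondegAtPoint (g : Metric n m M) (p : M) : Prop :=
  NondegAt (chartFun g.inner (chartAt (EuclideanHalfSpace n) p))
    (tangPart (extChartAt (𝓡∂ n) p p))

lemma mem_nondegenerate_iff (hm : 1 ≤ m) (g : Metric n m M) :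
    g ∈ nondegenerate n m M ↔ ∀ p ∈ (𝓡∂ n).boundary M, NondegAtPoint g p := by
  refine forall₂_congr fun p hp => ?_
  have h := bdryRead_eventuallyEq hm g hp
  exact ⟨fun h1 => NondegAt.congr h1 h.symm, fun h1 => NondegAt.congr h1 h⟩

lemma nondegAtPoint_iff (hm : 3 ≤ m) (g : Metric n m M)
    {e : OpenPartialHomeomorph M (EuclideanHalfSpace n)}
    (he : e ∈ IsManifold.maximalAtlas (𝓡∂ n) ((m : ℕ∞ω) + 1) M) {p : M}
    (hp : p ∈ (𝓡∂ n).boundary M) (hpe : p ∈ e.source) :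
    NondegAtPoint g p ↔ NondegAt (chartFun g.inner e) (tangPart (e.extend (𝓡∂ n) p)) := by
  have hc := IsManifold.chart_mem_maximalAtlas (I := 𝓡∂ n) (n := (m : ℕ∞ω) + 1) p
  have hps := mem_chart_source (EuclideanHalfSpace n) p
  have key : ∀ e₁ ∈ IsManifold.maximalAtlas (𝓡∂ n) ((m : ℕ∞ω) + 1) M,
      ∀ e₂ ∈ IsManifold.maximalAtlas (𝓡∂ n) ((m : ℕ∞ω) + 1) M, p ∈ e₁.source → p ∈ e₂.source →
      NondegAt (chartFun g.inner e₂) (tangPart (e₂.extend (𝓡∂ n) p)) →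
      NondegAt (chartFun g.inner e₁) (tangPart (e₁.extend (𝓡∂ n) p)) := by
    intro e₁ he₁ e₂ he₂ h₁ h₂ h
    have h0 := (mem_boundary_iff (mem_maximalAtlas_one he₁) h₁).1 hp
    have hs := extend_mem_transition_source (n := n) h₁ h₂
    rw [← inclBdry_tangPart h0] at hs
    refine NondegAt.chartFun_of_transition he₁ he₂ hs hm g ?_
    rwa [bdryTransition, inclBdry_tangPart h0, transition_extend h₁]
  exact ⟨key e he _ hc hpe hps, key _ hc e he hps hpe⟩

end Boundary

/-! ### Stability of non-degeneracy under perturbations of the 2-jet -/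

section TwoJets

variable {V W : Type*} [NormedAddCommGroup V] [NormedSpace ℝ V]
  [NormedAddCommGroup W] [NormedSpace ℝ W]

/-- The value and the first two derivatives of `b` at `y`. -/
def twoJet (b : V → W) (y : V) : W × (V →L[ℝ] W) × (V →L[ℝ] V →L[ℝ] W) :=
  (b y, fderiv ℝ b y, fderiv ℝ (fderiv ℝ b) y)

/-- The first two derivatives of `Φ ∘ b`, in terms of the 2-jet of `b`. -/
def pushTwoJet (Φ : W → ℝ) (q : W × (V →L[ℝ] W) × (V →L[ℝ] V →L[ℝ] W)) :
    (V →L[ℝ] ℝ) × (V →L[ℝ] V →L[ℝ] ℝ) :=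
  ((fderiv ℝ Φ q.1).comp q.2.1,
    (ContinuousLinearMap.compL ℝ V W ℝ (fderiv ℝ Φ q.1)).comp q.2.2 +
      ((ContinuousLinearMap.compL ℝ V W ℝ).flip q.2.1).comp
        ((fderiv ℝ (fderiv ℝ Φ) q.1).comp q.2.1))

lemma nondegAt_comp_iff {Φ : W → ℝ} {b : V → W} {y : V} (hΦ : ContDiffAt ℝ 2 Φ (b y))
    (hb : ContDiffAt ℝ 2 b y) :
    NondegAt (fun z => Φ (b z)) y ↔ pushTwoJet Φ (twoJet b y) ∈ morseJets V := by
  obtain ⟨h1, h2⟩ := fderiv_fderiv_comp hΦ hb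
  rw [NondegAt, h1, h2]
  rfl

lemma continuousAt_pushTwoJet {Φ : W → ℝ} {q : W × (V →L[ℝ] W) × (V →L[ℝ] V →L[ℝ] W)}
    (hΦ : ContDiffAt ℝ 2 Φ q.1) : ContinuousAt (pushTwoJet Φ) q := by
  have h1 : ContinuousAt (fun q : W × (V →L[ℝ] W) × (V →L[ℝ] V →L[ℝ] W) => fderiv ℝ Φ q.1) q :=
    ContinuousAt.comp (f := Prod.fst) (hΦ.fderiv_right (m := 1) le_rfl).continuousAt
      continuousAt_fst
  have h2 : ContinuousAt
      (fun q : W × (V →L[ℝ] W) × (V →L[ℝ] V →L[ℝ] W) => fderiv ℝ (fderiv ℝ Φ) q.1) q :=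
    ContinuousAt.comp (f := Prod.fst)
      ((hΦ.fderiv_right (m := 1) le_rfl).fderiv_right (m := 0) (by simp)).continuousAt
      continuousAt_fst
  have h3 : ContinuousAt (fun q : W × (V →L[ℝ] W) × (V →L[ℝ] V →L[ℝ] W) => q.2.1) q := by fun_prop
  have h4 : ContinuousAt (fun q : W × (V →L[ℝ] W) × (V →L[ℝ] V →L[ℝ] W) => q.2.2) q := by fun_prop
  have h5 := ((ContinuousLinearMap.compL ℝ V W ℝ).continuous.continuousAt.comp h1).clm_comp h4
  have h6 := ((ContinuousLinearMap.compL ℝ V W ℝ).flip.continuous.continuousAt.comp h3).clm_comp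
    (h2.clm_comp h3)
  exact (h1.clm_comp h3).prodMk (h5.add h6)

lemma continuousAt_twoJet {b : V → W} {y : V} (hb : ContDiffAt ℝ 2 b y) :
    ContinuousAt (twoJet b) y :=
  hb.continuousAt.prodMk ((hb.fderiv_right (m := 1) le_rfl).continuousAt.prodMk
    ((hb.fderiv_right (m := 1) le_rfl).fderiv_right (m := 0) (by simp)).continuousAt)

lemma exists_ball_pushTwoJet [FiniteDimensional ℝ V] {Φ : W → ℝ}
    {q : W × (V →L[ℝ] W) × (V →L[ℝ] V →L[ℝ] W)} (hΦ : ContDiffAt ℝ 2 Φ q.1)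
    (hq : pushTwoJet Φ q ∈ morseJets V) :
    ∃ δ > 0, ∀ q', ‖q' - q‖ < δ → pushTwoJet Φ q' ∈ morseJets V := by
  obtain ⟨δ, hδ, h⟩ := Metric.eventually_nhds_iff
    (α := W × (V →L[ℝ] W) × (V →L[ℝ] V →L[ℝ] W)) |>.1
    ((continuousAt_pushTwoJet hΦ).eventually_mem (isOpen_morseJets.mem_nhds hq))
  exact ⟨δ, hδ, fun q' hq' => h ((dist_eq_norm q' q).trans_lt hq')⟩

lemma eventually_norm_twoJet_sub_lt {b : V → W} {y : V} (hb : ContDiffAt ℝ 2 b y) {δ : ℝ}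
    (hδ : 0 < δ) : ∀ᶠ z in 𝓝 y, ‖twoJet b z - twoJet b y‖ < δ := by
  exact ((Metric.continuousAt_iff' (α := W × (V →L[ℝ] W) × (V →L[ℝ] V →L[ℝ] W))).1
    (continuousAt_twoJet hb) δ hδ).mono fun z hz =>
      (dist_eq_norm (twoJet b z) (twoJet b y)).symm.trans_lt hz

lemma twoJet_congr {b b' : V → W} {y : V} (h : b =ᶠ[𝓝 y] b') : twoJet b y = twoJet b' y :=
  Prod.ext h.eq_of_nhds (Prod.ext h.fderiv_eq h.fderiv.fderiv_eq)

lemma norm_twoJet_sub_le (q q' q'' : W × (V →L[ℝ] W) × (V →L[ℝ] V →L[ℝ] W)) :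
    ‖q - q''‖ ≤ ‖q - q'‖ + ‖q' - q''‖ := by
  have := norm_add_le (q - q') (q' - q'')
  rwa [sub_add_sub_cancel] at this

lemma twoJet_sub {b b' : V → W} {y : V} (hb : ContDiffAt ℝ 2 b y) (hb' : ContDiffAt ℝ 2 b' y) :
    twoJet (fun z => b' z - b z) y = twoJet b' y - twoJet b y := by
  have h1 : fderiv ℝ (fun z => b' z - b z) =ᶠ[𝓝 y] fun z => fderiv ℝ b' z - fderiv ℝ b z := by
    filter_upwards [hb.eventually (by simp), hb'.eventually (by simp)] with z h1 h2
    exact fderiv_fun_sub (h2.differentiableAt (by simp)) (h1.differentiableAt (by simp))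
  have h2 : fderiv ℝ (fderiv ℝ fun z => b' z - b z) y =
      fderiv ℝ (fderiv ℝ b') y - fderiv ℝ (fderiv ℝ b) y := by
    rw [h1.fderiv_eq]
    exact fderiv_fun_sub ((hb'.fderiv_right (m := 1) le_rfl).differentiableAt (by simp))
      ((hb.fderiv_right (m := 1) le_rfl).differentiableAt (by simp))
  simp only [twoJet, h1.eq_of_nhds, h2]
  rfl

/-- The 2-jet of a map is controlled by the 2-jets of its components. -/
lemma norm_twoJet_le {ι : Type*} (ℓ : ι → W →L[ℝ] ℝ)
    (hℓ : ∀ (w : W) (r : ℝ), 0 ≤ r → (∀ s, |ℓ s w| ≤ r) → ‖w‖ ≤ r)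
    {b : V → W} {y : V} (hb : ContDiffAt ℝ 2 b y) {η : ℝ} (hη : 0 ≤ η)
    (h0 : ∀ s, |ℓ s (b y)| ≤ η)
    (h1 : ∀ s v, |fderiv ℝ (fun z => ℓ s (b z)) y v| ≤ η * ‖v‖)
    (h2 : ∀ s u v, |fderiv ℝ (fderiv ℝ fun z => ℓ s (b z)) y u v| ≤ η * ‖u‖ * ‖v‖) :
    ‖twoJet b y‖ ≤ η := by
  have key := fun s => fderiv_fderiv_comp (Φ := ℓ s) (ψ := b) (y := y)
    (ℓ s).contDiff.contDiffAt hb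
  have hc : ∀ s, fderiv ℝ (fderiv ℝ (ℓ s)) (b y) = 0 := fun s => by
    have : fderiv ℝ (ℓ s) = fun _ => ℓ s := funext fun w => (ℓ s).fderiv
    rw [this]
    exact fderiv_const_apply _
  refine norm_prod_le_iff.2 ⟨hℓ _ _ hη h0, norm_prod_le_iff.2 ⟨?_, ?_⟩⟩
  · refine ContinuousLinearMap.opNorm_le_bound _ hη fun v => hℓ _ _ (by positivity) fun s => ?_
    have := h1 s v
    rw [(key s).1] at this
    change |ℓ s (fderiv ℝ b y v)| ≤ _
    simpa using this
  · refine ContinuousLinearMap.opNorm_le_bound _ hη fun u =>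
      ContinuousLinearMap.opNorm_le_bound _ (by positivity) fun v =>
        hℓ _ _ (by positivity) fun s => ?_
    have := h2 s u v
    rw [(key s).2, hc] at this
    change |ℓ s (fderiv ℝ (fderiv ℝ b) y u v)| ≤ _
    simpa using this

end TwoJets

/-! ### Derivatives along the boundary and the norm -/

section Bounds

variable {n : ℕ} [NeZero n]

lemma norm_inclBdry (y : EuclideanSpace ℝ (TIdx n)) : ‖inclBdry y‖ = ‖y‖ := by
  rw [EuclideanSpace.norm_eq, EuclideanSpace.norm_eq, sum_eq_sum_tIdx (by simp)]
  congr 1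
  refine Finset.sum_congr rfl fun i _ => ?_
  simp [inclBdry, i.2]

/-- Restricting to the boundary does not increase the derivatives of order at most two. -/
lemma bounds_comp_inclBdry {f : EuclideanSpace ℝ (Fin n) → ℝ} {y : EuclideanSpace ℝ (TIdx n)}
    (hf : ContDiffWithinAt ℝ 2 f (range (𝓡∂ n)) (inclBdry y)) {η : ℝ}
    (hη : ∀ r ≤ 2, ‖iteratedFDerivWithin ℝ r f (range (𝓡∂ n)) (inclBdry y)‖ ≤ η) :
    |f (inclBdry y)| ≤ η ∧
    (∀ v, |fderiv ℝ (fun z => f (inclBdry z)) y v| ≤ η * ‖v‖) ∧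
    ∀ u v, |fderiv ℝ (fderiv ℝ fun z => f (inclBdry z)) y u v| ≤ η * ‖u‖ * ‖v‖ := by
  have hu := (𝓡∂ n).uniqueDiffOn
  have hx := inclBdry_mem_range y
  have hev : ∀ᶠ z in 𝓝 y, ContDiffWithinAt ℝ 2 f (range (𝓡∂ n)) (inclBdry z) := by
    have := hf.eventually (by simp)
    rw [insert_eq_of_mem hx] at this
    exact (tendsto_inclBdry y).eventually this
  have hd : ∀ z, ContDiffWithinAt ℝ 2 f (range (𝓡∂ n)) (inclBdry z) →
      fderiv ℝ (fun z => f (inclBdry z)) z =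
        (fderivWithin ℝ f (range (𝓡∂ n)) (inclBdry z)).comp (inclL n) := fun z hz =>
    ((hz.differentiableWithinAt (by simp)).hasFDerivWithinAt.comp_hasFDerivAt z
      (inclL n).hasFDerivAt (Eventually.of_forall inclBdry_mem_range)).fderiv
  have hev2 : fderiv ℝ (fun z => f (inclBdry z)) =ᶠ[𝓝 y]
      fun z => (fderivWithin ℝ f (range (𝓡∂ n)) (inclBdry z)).comp (inclL n) := hev.mono hd
  have hD := (hf.fderivWithin_right (m := 1) hu le_rfl hx).differentiableWithinAt (by simp)
  have hD2 := hD.hasFDerivWithinAt.comp_hasFDerivAt y (inclL n).hasFDerivAt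
    (Eventually.of_forall inclBdry_mem_range)
  have hD3 := hD2.clm_comp (hasFDerivAt_const (inclL n) y)
  have n0 : ‖f (inclBdry y)‖ ≤ η := by
    simpa only [norm_iteratedFDerivWithin_zero] using hη 0 (by norm_num)
  have n1 : ‖fderivWithin ℝ f (range (𝓡∂ n)) (inclBdry y)‖ ≤ η := by
    have := hη 1 (by norm_num)
    rwa [← zero_add 1, ← norm_iteratedFDerivWithin_fderivWithin hu hx,
      norm_iteratedFDerivWithin_zero] at this
  have n2 : ‖fderivWithin ℝ (fderivWithin ℝ f (range (𝓡∂ n))) (range (𝓡∂ n)) (inclBdry y)‖ ≤ η := by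
    have := hη 2 le_rfl
    rwa [← one_add_one_eq_two, ← norm_iteratedFDerivWithin_fderivWithin hu hx, ← zero_add 1,
      ← norm_iteratedFDerivWithin_fderivWithin hu hx, norm_iteratedFDerivWithin_zero] at this
  refine ⟨n0, fun v => ?_, fun u v => ?_⟩
  · rw [hd y hf, ContinuousLinearMap.comp_apply, inclL_apply, ← norm_inclBdry v]
    exact ContinuousLinearMap.le_of_opNorm_le _ n1 _
  · rw [hev2.fderiv_eq]
    have h4 : fderiv ℝ (fun z => (fderivWithin ℝ f (range (𝓡∂ n)) (inclBdry z)).comp (inclL n)) y u v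
        = fderivWithin ℝ (fderivWithin ℝ f (range (𝓡∂ n))) (range (𝓡∂ n)) (inclBdry y)
          (inclBdry u) (inclBdry v) := by
      rw [show fderiv ℝ (fun z => (fderivWithin ℝ f (range (𝓡∂ n)) (inclBdry z)).comp (inclL n)) y
        = _ from hD3.fderiv]
      simp
    rw [h4, ← norm_inclBdry u, ← norm_inclBdry v]
    exact ContinuousLinearMap.le_of_opNorm₂_le_of_le _ n2 le_rfl le_rfl

/-- The coordinates of a jet. -/
def jetCoord (s : (Fin n × Fin n) ⊕ (Fin n × Fin n × Fin n)) : Jet n →L[ℝ] ℝ :=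
  match s with
  | .inl s => (ContinuousLinearMap.proj (R := ℝ) (φ := fun _ : Fin n => ℝ) s.2).comp
      ((ContinuousLinearMap.proj (R := ℝ) (φ := fun _ : Fin n => Fin n → ℝ) s.1).comp
        (ContinuousLinearMap.fst ℝ _ _))
  | .inr s => (ContinuousLinearMap.proj (R := ℝ) (φ := fun _ : Fin n => ℝ) s.2.2).comp
      ((ContinuousLinearMap.proj (R := ℝ) (φ := fun _ : Fin n => Fin n → ℝ) s.2.1).comp
        ((ContinuousLinearMap.proj (R := ℝ) (φ := fun _ : Fin n => Fin n → Fin n → ℝ) s.1).comp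
          (ContinuousLinearMap.snd ℝ _ _)))

lemma norm_le_of_jetCoord (w : Jet n) (r : ℝ) (hr : 0 ≤ r) (h : ∀ s, |jetCoord s w| ≤ r) :
    ‖w‖ ≤ r := by
  refine norm_prod_le_iff.2 ⟨?_, ?_⟩
  · exact (pi_norm_le_iff_of_nonneg hr).2 fun i => (pi_norm_le_iff_of_nonneg hr).2 fun j =>
      h (.inl (i, j))
  · exact (pi_norm_le_iff_of_nonneg hr).2 fun c => (pi_norm_le_iff_of_nonneg hr).2 fun i =>
      (pi_norm_le_iff_of_nonneg hr).2 fun j => h (.inr (c, i, j))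

variable {M : Type*} [TopologicalSpace M] [ChartedSpace (EuclideanHalfSpace n) M]

/-- The 2-jet along the boundary of the first-order jet of a tensor is controlled by the
derivatives of order at most three of its components. -/
lemma norm_twoJet_jet_le {k : TensorField n M} {e : OpenPartialHomeomorph M (EuclideanHalfSpace n)}
    {y : EuclideanSpace ℝ (TIdx n)}
    (hk : ∀ i j, ContDiffWithinAt ℝ 3 (comp k e i j) (range (𝓡∂ n)) (inclBdry y)) {η : ℝ}
    (hη : ∀ i j, ∀ r ≤ 3,
      ‖iteratedFDerivWithin ℝ r (comp k e i j) (range (𝓡∂ n)) (inclBdry y)‖ ≤ η) :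
    ‖twoJet (fun z => jet k e (inclBdry z)) y‖ ≤ η := by
  have hu := (𝓡∂ n).uniqueDiffOn
  have hx := inclBdry_mem_range y
  have hη0 : 0 ≤ η := (norm_nonneg _).trans (hη 0 0 0 (by norm_num))
  let F : (Fin n × Fin n) ⊕ (Fin n × Fin n × Fin n) → EuclideanSpace ℝ (Fin n) → ℝ :=
    fun s x => jetCoord s (jet k e x)
  have hD : ∀ i j, ContDiffWithinAt ℝ 2 (fderivWithin ℝ (comp k e i j) (range (𝓡∂ n)))
      (range (𝓡∂ n)) (inclBdry y) := fun i j =>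
    (hk i j).fderivWithin_right (m := 2) hu (by norm_num) hx
  have hF : ∀ s, ContDiffWithinAt ℝ 2 (F s) (range (𝓡∂ n)) (inclBdry y) := by
    rintro (⟨i, j⟩ | ⟨c, i, j⟩)
    · exact (hk i j).of_le (by norm_num)
    · exact (hD i j).clm_apply contDiffWithinAt_const
  have hFη : ∀ s, ∀ r ≤ 2, ‖iteratedFDerivWithin ℝ r (F s) (range (𝓡∂ n)) (inclBdry y)‖ ≤ η := by
    rintro (⟨i, j⟩ | ⟨c, i, j⟩) r hr
    · exact hη i j r (by omega)
    · have h1 := norm_iteratedFDerivWithin_clm_apply_const (c := EuclideanSpace.single c (1 : ℝ))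
        (hD i j) hu hx (N := 2) (n := r) (by exact_mod_cast hr)
      refine h1.trans ?_
      rw [norm_iteratedFDerivWithin_fderivWithin hu hx]
      simpa using hη i j (r + 1) (by omega)
  have hb : ContDiffAt ℝ 2 (fun z => jet k e (inclBdry z)) y := by
    have h1 : ContDiffWithinAt ℝ 2 (jet k e) (range (𝓡∂ n)) (inclBdry y) := by
      refine ContDiffWithinAt.prodMk ?_ ?_
      · exact contDiffWithinAt_pi.2 fun i => contDiffWithinAt_pi.2 fun j => hF (.inl (i, j))
      · exact contDiffWithinAt_pi.2 fun c => contDiffWithinAt_pi.2 fun i =>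
          contDiffWithinAt_pi.2 fun j => hF (.inr (c, i, j))
    exact h1.comp y contDiff_inclBdry.contDiffAt (s := univ) (fun z _ => inclBdry_mem_range z)
  have hB := fun s => bounds_comp_inclBdry (hF s) (hFη s)
  exact norm_twoJet_le jetCoord norm_le_of_jetCoord hb hη0 (fun s => (hB s).1)
    (fun s => (hB s).2.1) (fun s => (hB s).2.2)

lemma enorm_iteratedFDerivWithin_le_cmNorm {m : ℕ} (C : ChartCover n m M) (k : TensorField n M)
    (a : C.ι) {p : M} (hp : p ∈ C.V a) {r : ℕ} (hr : r ≤ m) (i j : Fin n) :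
    ‖iteratedFDerivWithin ℝ r (comp k (C.chart a) i j) (range (𝓡∂ n))
      ((C.chart a).extend (𝓡∂ n) p)‖ₑ ≤ cmNorm C k := by
  have h1 : ‖iteratedFDerivWithin ℝ r (comp k (C.chart a) i j) (range (𝓡∂ n))
      ((C.chart a).extend (𝓡∂ n) p)‖ₑ ≤ ⨆ x ∈ (C.chart a).extend (𝓡∂ n) '' C.V a,
      ‖iteratedFDerivWithin ℝ r (comp k (C.chart a) i j) (range (𝓡∂ n)) x‖ₑ :=
    le_iSup₂ (f := fun x (_ : x ∈ (C.chart a).extend (𝓡∂ n) '' C.V a) =>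
      ‖iteratedFDerivWithin ℝ r (comp k (C.chart a) i j) (range (𝓡∂ n)) x‖ₑ) _
      (mem_image_of_mem _ hp)
  refine h1.trans ?_
  refine le_trans ?_ (Finset.single_le_sum_of_canonicallyOrdered (Finset.mem_univ a))
  refine le_trans ?_ (Finset.single_le_sum_of_canonicallyOrdered
    (Finset.mem_range.2 (Nat.lt_succ_of_le hr)))
  refine le_trans ?_ (Finset.single_le_sum_of_canonicallyOrdered (Finset.mem_univ i))
  exact Finset.single_le_sum_of_canonicallyOrdered
    (f := fun j => ⨆ x ∈ (C.chart a).extend (𝓡∂ n) '' C.V a,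
      ‖iteratedFDerivWithin ℝ r (comp k (C.chart a) i j) (range (𝓡∂ n)) x‖ₑ) (Finset.mem_univ j)

end Bounds

/-! ### Openness -/

section Openness

variable {n : ℕ} [NeZero n] {M : Type*} [TopologicalSpace M]
  [ChartedSpace (EuclideanHalfSpace n) M]
  [IsManifold (𝓡∂ n) 1 M] {m : ℕ} [IsManifold (𝓡∂ n) ((m : ℕ∞ω) + 1) M]

lemma comp_sub (k k' : TensorField n M) (e : OpenPartialHomeomorph M (EuclideanHalfSpace n))
    (i j : Fin n) :
    comp (fun p => k' p - k p) e i j = fun x => comp k' e i j x - comp k e i j x := rfl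

lemma contDiffWithinAt_comp {e : OpenPartialHomeomorph M (EuclideanHalfSpace n)}
    (he : e ∈ IsManifold.maximalAtlas (𝓡∂ n) ((m : ℕ∞ω) + 1) M) (g : Metric n m M) (i j : Fin n)
    {x : EuclideanSpace ℝ (Fin n)} (hx : x ∈ (e.extend (𝓡∂ n)).target) :
    ContDiffWithinAt ℝ m (comp g.inner e i j) (range (𝓡∂ n)) x :=
  (contDiffOn_comp he g i j x hx).mono_of_mem_nhdsWithin (extend_target_mem_nhdsWithin' hx)

lemma jet_sub (hm : 1 ≤ m) {e : OpenPartialHomeomorph M (EuclideanHalfSpace n)}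
    (he : e ∈ IsManifold.maximalAtlas (𝓡∂ n) ((m : ℕ∞ω) + 1) M) (g g' : Metric n m M)
    {x : EuclideanSpace ℝ (Fin n)} (hx : x ∈ (e.extend (𝓡∂ n)).target) :
    jet (fun p => g'.inner p - g.inner p) e x = jet g'.inner e x - jet g.inner e x := by
  have hd : ∀ (g : Metric n m M) i j,
      DifferentiableWithinAt ℝ (comp g.inner e i j) (range (𝓡∂ n)) x := fun g i j =>
    (contDiffWithinAt_comp he g i j hx).differentiableWithinAt
      (by exact_mod_cast (by omega : m ≠ 0))
  refine Prod.ext rfl ?_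
  ext c i j
  change fderivWithin ℝ (comp (fun p => g'.inner p - g.inner p) e i j) (range (𝓡∂ n)) x _ = _
  rw [comp_sub, fderivWithin_fun_sub ((𝓡∂ n).uniqueDiffOn x (e.extend_target_subset_range hx))
    (hd g' i j) (hd g i j)]
  rfl

/-- The Morse condition at a boundary point persists for nearby points and nearby metrics. -/
lemma exists_nhds_nondegAtPoint (hm : 3 ≤ m) (C : ChartCover n m M) (g : Metric n m M) {p₀ : M}
    (hp₀ : p₀ ∈ (𝓡∂ n).boundary M) (h : NondegAtPoint g p₀) :
    ∃ U ∈ 𝓝 p₀, ∃ ε : ℝ≥0∞, 0 < ε ∧ ∀ g' : Metric n m M,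
      cmNorm C (fun p => g'.inner p - g.inner p) < ε →
        ∀ q ∈ U, q ∈ (𝓡∂ n).boundary M → NondegAtPoint g' q := by
  obtain ⟨a, ha⟩ : ∃ a, p₀ ∈ C.V a := by
    have := C.iUnion_eq ▸ mem_univ p₀
    simpa using this
  set e := C.chart a with he_def
  have he : e ∈ IsManifold.maximalAtlas (𝓡∂ n) ((m : ℕ∞ω) + 1) M := C.chart_mem a
  have he1 := mem_maximalAtlas_one he
  have hVs : C.V a ⊆ e.source := subset_closure.trans (C.closure_subset a)
  have hT : ∀ q ∈ C.V a, e.extend (𝓡∂ n) q ∈ (e.extend (𝓡∂ n)).target := fun q hq =>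
    (e.extend (𝓡∂ n)).map_source (by simpa using hVs hq)
  let b : Metric n m M → EuclideanSpace ℝ (TIdx n) → Jet n :=
    fun g y => jet g.inner e (inclBdry y)
  let Y : M → EuclideanSpace ℝ (TIdx n) := fun q => tangPart (e.extend (𝓡∂ n) q)
  have hY : ∀ q ∈ C.V a, q ∈ (𝓡∂ n).boundary M → inclBdry (Y q) = e.extend (𝓡∂ n) q :=
    fun q hq hqb => inclBdry_tangPart ((mem_boundary_iff he1 (hVs hq)).1 hqb)
  have hcrit : ∀ (g : Metric n m M), ∀ q ∈ C.V a, q ∈ (𝓡∂ n).boundary M →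
      (NondegAtPoint g q ↔ pushTwoJet jetNormSq (twoJet (b g) (Y q)) ∈
        morseJets (EuclideanSpace ℝ (TIdx n))) := by
    intro g q hq hqb
    have hy : inclBdry (Y q) ∈ (e.extend (𝓡∂ n)).target := by
      rw [hY q hq hqb]; exact hT q hq
    rw [nondegAtPoint_iff hm g he hqb (hVs hq)]
    exact nondegAt_comp_iff (b := b g) (contDiffAt_jetNormSq (posDef_jetGram g he1 hy))
      (contDiffAt_jet_inclBdry he hm g hy)
  have hy₀ : inclBdry (Y p₀) ∈ (e.extend (𝓡∂ n)).target := by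
    rw [hY p₀ ha hp₀]; exact hT p₀ ha
  obtain ⟨δ, hδ, hball⟩ := exists_ball_pushTwoJet (q := twoJet (b g) (Y p₀))
    (contDiffAt_jetNormSq (posDef_jetGram g he1 hy₀)) ((hcrit g p₀ ha hp₀).1 h)
  have hYc : ContinuousAt Y p₀ :=
    (tangL n).continuous.continuousAt.comp (e.continuousAt_extend (hVs ha))
  have hU := hYc.eventually (eventually_norm_twoJet_sub_lt (b := b g)
    (contDiffAt_jet_inclBdry he hm g hy₀) (half_pos hδ))
  refine ⟨_, inter_mem hU ((C.isOpen a).mem_nhds ha), ENNReal.ofReal (δ / 2),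
    ENNReal.ofReal_pos.2 (half_pos hδ), ?_⟩
  rintro g' hg' q ⟨hq1, hq2⟩ hqb
  rw [hcrit g' q hq2 hqb]
  refine hball _ ?_
  have hy : inclBdry (Y q) ∈ (e.extend (𝓡∂ n)).target := by
    rw [hY q hq2 hqb]; exact hT q hq2
  have h3 : ((3 : ℕ) : ℕ∞ω) ≤ (m : ℕ∞ω) := by exact_mod_cast hm
  -- The 2-jets of `g'` and `g` at the same point are close by the `C^3` part of the norm, those of
  -- `g` at nearby points by continuity.
  set η := (cmNorm C (fun p => g'.inner p - g.inner p)).toReal with hη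
  have hηlt : η < δ / 2 := (ENNReal.lt_ofReal_iff_toReal_lt hg'.ne_top).1 hg'
  have hbound : ‖twoJet (fun z => jet (fun p => g'.inner p - g.inner p) e (inclBdry z)) (Y q)‖
      ≤ η := by
    refine norm_twoJet_jet_le (fun i j => ?_) (fun i j r hr => ?_)
    · exact ((contDiffWithinAt_comp he g' i j hy).sub (contDiffWithinAt_comp he g i j hy)).of_le h3
    · rw [hY q hq2 hqb]
      have := enorm_iteratedFDerivWithin_le_cmNorm C (fun p => g'.inner p - g.inner p) a hq2
        (hr.trans hm) i j
      rw [← toReal_enorm]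
      exact ENNReal.toReal_mono hg'.ne_top this
  have heq : twoJet (fun z => jet (fun p => g'.inner p - g.inner p) e (inclBdry z)) (Y q) =
      twoJet (b g') (Y q) - twoJet (b g) (Y q) := by
    rw [← twoJet_sub (contDiffAt_jet_inclBdry he hm g hy) (contDiffAt_jet_inclBdry he hm g' hy)]
    have hev : (fun z => jet (fun p => g'.inner p - g.inner p) e (inclBdry z)) =ᶠ[𝓝 (Y q)]
        fun z => b g' z - b g z := by
      filter_upwards [(tendsto_inclBdry (Y q)).eventually (extend_target_mem_nhdsWithin' hy)]
        with z hz
      exact jet_sub (by omega) he g g' hz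
    exact twoJet_congr hev
  rw [heq] at hbound
  calc ‖twoJet (b g') (Y q) - twoJet (b g) (Y p₀)‖
      ≤ ‖twoJet (b g') (Y q) - twoJet (b g) (Y q)‖ +
        ‖twoJet (b g) (Y q) - twoJet (b g) (Y p₀)‖ := norm_twoJet_sub_le _ _ _
    _ < δ / 2 + δ / 2 := add_lt_add (hbound.trans_lt hηlt) hq1
    _ = δ := add_halves δ

/-- For a compact set `K`, the Morse condition at the boundary points in `K` is open in the `C^m`
topology. -/
lemma isOpen_nondegAtPoint_of_isCompact (hm : 3 ≤ m) (C : ChartCover n m M) {K : Set M}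
    (hK : IsCompact K) :
    IsOpen[cmTopology C] {g : Metric n m M | ∀ p ∈ K, p ∈ (𝓡∂ n).boundary M →
      NondegAtPoint g p} := by
  intro g hg
  let P : Set M → Prop := fun S => ∃ ε : ℝ≥0∞, 0 < ε ∧ ∀ g' : Metric n m M,
      cmNorm C (fun p => g'.inner p - g.inner p) < ε →
        ∀ q ∈ S, q ∈ (𝓡∂ n).boundary M → NondegAtPoint g' q
  have hP : P K := by
    refine hK.induction_on (p := P) ⟨1, one_pos, fun _ _ _ h => h.elim⟩ ?_ ?_ ?_
    · rintro S S' hS ⟨ε, h0, h⟩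
      exact ⟨ε, h0, fun g' hg' q hq => h g' hg' q (hS hq)⟩
    · rintro S S' ⟨ε, h0, h⟩ ⟨ε', h0', h'⟩
      refine ⟨min ε ε', lt_min h0 h0', fun g' hg' q hq => ?_⟩
      rcases hq with hq | hq
      · exact h g' (hg'.trans_le (min_le_left _ _)) q hq
      · exact h' g' (hg'.trans_le (min_le_right _ _)) q hq
    · intro p hp
      by_cases hpb : p ∈ (𝓡∂ n).boundary M
      · obtain ⟨U, hU, ε, hε, h⟩ := exists_nhds_nondegAtPoint hm C g hpb (hg p hp hpb)
        exact ⟨U, mem_nhdsWithin_of_mem_nhds hU, ε, hε, h⟩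
      · have hcl : IsClosed ((𝓡∂ n).boundary M) :=
          (𝓡∂ n).isClosed_boundary (n := 1) one_ne_zero
        exact ⟨_, mem_nhdsWithin_of_mem_nhds (hcl.isOpen_compl.mem_nhds hpb), 1, one_pos,
          fun _ _ q hq hq' => (hq hq').elim⟩
  exact hP

end Openness

/-! ### Smooth families of functions -/

section Parameters

variable {A E : Type*} [NormedAddCommGroup A] [NormedSpace ℝ A]
  [NormedAddCommGroup E] [NormedSpace ℝ E]

open scoped Pointwise in
lemma iteratedFDerivWithin_prodMk_left {m : ℕ∞ω} {T : Set E} (hT : UniqueDiffOn ℝ T)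
    {Ψ : A × E → ℝ} (hΨ : ContDiffOn ℝ m Ψ (univ ×ˢ T)) {r : ℕ} (hr : r ≤ m) (a : A) {x : E}
    (hx : x ∈ T) :
    iteratedFDerivWithin ℝ r (fun x => Ψ (a, x)) T x =
      (iteratedFDerivWithin ℝ r Ψ (univ ×ˢ T) (a, x)).compContinuousLinearMap
        fun _ => ContinuousLinearMap.inr ℝ A E := by
  have hpre : ContinuousLinearMap.inr ℝ A E ⁻¹' (univ ×ˢ T) = T := by ext z; simp
  have hs : (a, (0 : E)) +ᵥ (univ ×ˢ T : Set (A × E)) = univ ×ˢ T := by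
    ext ⟨b, z⟩
    simp [mem_vadd_set_iff_neg_vadd_mem]
  have hshift : ContDiffOn ℝ m (fun z => Ψ ((a, 0) + z)) (univ ×ˢ T) :=
    hΨ.comp (contDiff_const.add contDiff_id).contDiffOn fun z hz => by simpa using hz
  have h := (ContinuousLinearMap.inr ℝ A E).iteratedFDerivWithin_comp_right hshift
    (uniqueDiffOn_univ.prod hT) (hpre.symm ▸ hT) (x := x) (by simpa using hx) hr
  rw [hpre, iteratedFDerivWithin_comp_add_left, hs] at h
  simpa [Function.comp_def] using h

/-- Smooth dependence on a parameter: if `Ψ(a₀, ·) = 0`, then the derivatives of `Ψ(a, ·)` are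
uniformly small on compact sets for `a` close to `a₀`. -/
lemma eventually_norm_iteratedFDerivWithin_lt {m : ℕ∞ω} {T : Set E} (hT : UniqueDiffOn ℝ T)
    {Ψ : A × E → ℝ} (hΨ : ContDiffOn ℝ m Ψ (univ ×ˢ T)) {a₀ : A}
    (h0 : ∀ x, Ψ (a₀, x) = 0) {K : Set E} (hK : IsCompact K) (hKT : K ⊆ T) {r : ℕ}
    (hr : r ≤ m) {ε : ℝ} (hε : 0 < ε) :
    ∀ᶠ a in 𝓝 a₀, ∀ x ∈ K, ‖iteratedFDerivWithin ℝ r (fun x => Ψ (a, x)) T x‖ < ε := by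
  have key : ∀ᶠ a in 𝓝 a₀, ∀ x ∈ K, x ∈ T →
      ‖iteratedFDerivWithin ℝ r (fun x => Ψ (a, x)) T x‖ < ε := by
    refine hK.eventually_forall_of_forall_eventually fun x hx => ?_
    have hxT := hKT hx
    have hc := (hΨ.continuousOn_iteratedFDerivWithin hr (uniqueDiffOn_univ.prod hT))
      (a₀, x) ⟨mem_univ _, hxT⟩
    have hc' := (ContinuousMultilinearMap.compContinuousLinearMapL (𝕜 := ℝ) (F := ℝ)
      fun _ : Fin r => ContinuousLinearMap.inr ℝ A E).continuous.continuousAt.comp_continuousWithinAt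
        hc
    -- The derivatives in the direction of `a` need not vanish at `a₀`: only the restriction to
    -- the second factor does.
    have hz : (iteratedFDerivWithin ℝ r Ψ (univ ×ˢ T) (a₀, x)).compContinuousLinearMap
        (fun _ => ContinuousLinearMap.inr ℝ A E) = 0 := by
      rw [← iteratedFDerivWithin_prodMk_left hT hΨ hr a₀ hxT]
      simp only [h0, iteratedFDerivWithin_fun_zero, Pi.zero_apply]
    have hlt := hc'.norm.eventually_lt_const (u := ε) (by
      change ‖(iteratedFDerivWithin ℝ r Ψ (univ ×ˢ T) (a₀, x)).compContinuousLinearMap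
        (fun _ => ContinuousLinearMap.inr ℝ A E)‖ < ε
      rw [hz, norm_zero]
      exact hε)
    filter_upwards [eventually_nhdsWithin_iff.1 hlt] with z hz hzT
    rw [iteratedFDerivWithin_prodMk_left hT hΨ hr z.1 hzT]
    exact hz ⟨mem_univ _, hzT⟩
  filter_upwards [key] with a ha x hx using ha x hx (hKT hx)

end Parameters

/-! ### Conformal metrics -/

section Conformal

variable {n : ℕ} [NeZero n] {M : Type*} [TopologicalSpace M]
  [ChartedSpace (EuclideanHalfSpace n) M] [IsManifold (𝓡∂ n) 1 M] {m : ℕ}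

/-- The conformal metric `exp(-v) g`. -/
def conformal (g : Metric n m M) (v : M → ℝ) (hv : ContMDiff (𝓡∂ n) 𝓘(ℝ) m v) :
    Metric n m M where
  inner p := Real.exp (-v p) • g.inner p
  symm p x y := by
    change Real.exp (-v p) * g.inner p x y = Real.exp (-v p) * g.inner p y x
    rw [g.symm]
  pos p x hx := mul_pos (Real.exp_pos _) (g.pos p x hx)
  isVonNBounded p := by
    -- The unit ball of `exp(-v) g` is the unit ball of `g`, dilated by `exp(v/2)`.
    have h := (g.isVonNBounded p).image
      (Real.exp (v p / 2) • ContinuousLinearMap.id ℝ (TangentSpace (𝓡∂ n) p))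
    refine h.subset fun x hx => (mem_image _ _ _).2 ⟨Real.exp (-(v p) / 2) • x, ?_, ?_⟩
    · change g.inner p (Real.exp (-(v p) / 2) • x) (Real.exp (-(v p) / 2) • x) < 1
      have hx' : Real.exp (-v p) * g.inner p x x < 1 := hx
      simp only [map_smul, smul_apply, smul_eq_mul]
      rw [← mul_assoc, ← Real.exp_add, add_halves]
      exact hx'
    · change Real.exp (v p / 2) • Real.exp (-(v p) / 2) • x = x
      rw [smul_smul, ← Real.exp_add]
      rw [show v p / 2 + -v p / 2 = 0 by ring, Real.exp_zero, one_smul]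
  contMDiff := ContMDiff.smul_section
    ((Real.contDiff_exp.comp contDiff_neg).contMDiff.comp hv) g.contMDiff

variable [IsManifold (𝓡∂ n) ((m : ℕ∞ω) + 1) M]

lemma contDiffOn_comp_extend_symm {v : M → ℝ} (hv : ContMDiff (𝓡∂ n) 𝓘(ℝ) m v)
    {e : OpenPartialHomeomorph M (EuclideanHalfSpace n)}
    (he : e ∈ IsManifold.maximalAtlas (𝓡∂ n) ((m : ℕ∞ω) + 1) M) :
    ContDiffOn ℝ m (v ∘ (e.extend (𝓡∂ n)).symm) (e.extend (𝓡∂ n)).target :=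
  contMDiffOn_iff_contDiffOn.1 (hv.comp_contMDiffOn
    ((contMDiffOn_extend_symm_target he).of_le (le_self_add (b := 1))))

lemma contMDiff_sum_smul {ι : Type*} [Fintype ι] {u : ι → M → ℝ}
    (hu : ∀ i, ContMDiff (𝓡∂ n) 𝓘(ℝ) m (u i)) (a : ι → ℝ) :
    ContMDiff (𝓡∂ n) 𝓘(ℝ) m fun p => ∑ i, a i * u i p :=
  contMDiff_finsetSum fun i _ => contMDiff_const.mul (hu i)

/-- The `C^m` distance between `g` and `exp(-∑ aᵢ uᵢ) g` tends to zero with `a`. -/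
lemma tendsto_cmNorm_conformal [CompactSpace M] (C : ChartCover n m M) (g : Metric n m M)
    {ι : Type*} [Fintype ι] {u : ι → M → ℝ} (hu : ∀ i, ContMDiff (𝓡∂ n) 𝓘(ℝ) m (u i)) :
    Tendsto (fun a : EuclideanSpace ℝ ι => cmNorm C fun p =>
      (conformal g (fun p => ∑ i, a i * u i p) (contMDiff_sum_smul hu a)).inner p - g.inner p)
      (𝓝 0) (𝓝 0) := by
  unfold cmNorm
  have hsum : ∀ {κ : Type} (s : Finset κ) (f : κ → EuclideanSpace ℝ ι → ℝ≥0∞),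
      (∀ k ∈ s, Tendsto (f k) (𝓝 0) (𝓝 0)) →
        Tendsto (fun a => ∑ k ∈ s, f k a) (𝓝 0) (𝓝 0) := fun s f h => by
    simpa using tendsto_finsetSum s h
  refine hsum _ _ fun b _ => hsum _ _ fun r hr => hsum _ _ fun i _ => hsum _ _ fun j _ => ?_
  rw [ENNReal.tendsto_nhds_zero]
  intro ε hε
  set e := C.chart b
  have he : e ∈ IsManifold.maximalAtlas (𝓡∂ n) ((m : ℕ∞ω) + 1) M := C.chart_mem b
  set T := (e.extend (𝓡∂ n)).target
  have hsub : closure (C.V b) ⊆ (e.extend (𝓡∂ n)).source := by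
    rw [e.extend_source]; exact C.closure_subset b
  have hK : IsCompact (e.extend (𝓡∂ n) '' closure (C.V b)) :=
    isClosed_closure.isCompact.image_of_continuousOn
      (e.continuousOn_extend.mono hsub)
  have hKT : e.extend (𝓡∂ n) '' closure (C.V b) ⊆ T := by
    rintro _ ⟨p, hp, rfl⟩
    exact (e.extend (𝓡∂ n)).map_source (hsub hp)
  let Ψ : EuclideanSpace ℝ ι × EuclideanSpace ℝ (Fin n) → ℝ := fun z =>
    (Real.exp (-∑ k, z.1 k * u k ((e.extend (𝓡∂ n)).symm z.2)) - 1) * comp g.inner e i j z.2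
  have hΨ : ContDiffOn ℝ m Ψ (univ ×ˢ T) := by
    have h2 : MapsTo Prod.snd (univ ×ˢ T : Set (EuclideanSpace ℝ ι × EuclideanSpace ℝ (Fin n))) T :=
      fun z hz => hz.2
    have hk : ∀ k, ContDiffOn ℝ m (fun z : EuclideanSpace ℝ ι × EuclideanSpace ℝ (Fin n) =>
        z.1 k * u k ((e.extend (𝓡∂ n)).symm z.2)) (univ ×ˢ T) := fun k => by
      refine ContDiffOn.mul ?_ ((contDiffOn_comp_extend_symm (hu k) he).comp contDiffOn_snd h2)
      have : ContDiff ℝ m fun z : EuclideanSpace ℝ ι × EuclideanSpace ℝ (Fin n) => z.1 k := by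
        fun_prop
      exact this.contDiffOn
    refine ContDiffOn.mul ?_ ((contDiffOn_comp he g i j).comp contDiffOn_snd h2)
    refine ContDiffOn.sub ?_ contDiffOn_const
    refine ContDiffOn.exp (ContDiffOn.neg ?_)
    exact ContDiffOn.sum fun k _ => hk k
  have hr' : (r : ℕ∞ω) ≤ m := by
    exact_mod_cast Nat.lt_succ_iff.1 (Finset.mem_range.1 hr)
  obtain ⟨δ, hδ, hδε⟩ : ∃ δ : ℝ, 0 < δ ∧ ENNReal.ofReal δ ≤ ε := by
    rcases eq_or_ne ε ⊤ with rfl | hε'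
    · exact ⟨1, one_pos, le_top⟩
    · exact ⟨ε.toReal, ENNReal.toReal_pos hε.ne' hε', ENNReal.ofReal_toReal_le⟩
  filter_upwards [eventually_norm_iteratedFDerivWithin_lt (uniqueDiffOn_extend_target e) hΨ
    (a₀ := 0) (fun x => by simp [Ψ]) hK hKT hr' hδ] with a ha
  refine iSup₂_le ?_
  rintro _ ⟨p, hp, rfl⟩
  have hpK := mem_image_of_mem (e.extend (𝓡∂ n)) (subset_closure hp)
  have h1 := ha _ hpK
  refine le_trans ?_ hδε
  rw [← iteratedFDerivWithin_congr_set (extend_target_eventuallyEq' (hKT hpK)),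
    ← ofReal_norm]
  refine ENNReal.ofReal_le_ofReal (le_of_eq_of_le ?_ h1.le)
  congr 2
  funext x
  change Real.exp (-∑ k, a k * u k ((e.extend (𝓡∂ n)).symm x)) * comp g.inner e i j x -
    comp g.inner e i j x = _
  simp only [Ψ]
  ring

end Conformal

/-! ### Functions with vanishing normal derivative -/

section NormalDerivative

variable {n : ℕ} [NeZero n] {M : Type*} [TopologicalSpace M]
  [ChartedSpace (EuclideanHalfSpace n) M] [IsManifold (𝓡∂ n) 1 M] {m : ℕ}

/-- The partial derivatives of a function on `M` in the chart `e`. -/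
def partialDeriv (v : M → ℝ) (e : OpenPartialHomeomorph M (EuclideanHalfSpace n))
    (x : EuclideanSpace ℝ (Fin n)) (d : Fin n) : ℝ :=
  fderivWithin ℝ (v ∘ (e.extend (𝓡∂ n)).symm) (range (𝓡∂ n)) x (EuclideanSpace.single d (1 : ℝ))

/-- The component `∑ g^{0d} ∂_d v` of the gradient of `v` in the chart `e`. At a boundary point it
is a nonzero multiple of the normal derivative of `v`. -/
def gradZero (k : TensorField n M) (v : M → ℝ)
    (e : OpenPartialHomeomorph M (EuclideanHalfSpace n)) (x : EuclideanSpace ℝ (Fin n)) : ℝ :=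
  ∑ d, (jetGram (jet k e x))⁻¹ 0 d * partialDeriv v e x d

/-- The normal derivative of `v` vanishes at the point `p`. -/
def IsNeumannAt (k : TensorField n M) (v : M → ℝ) (p : M) : Prop :=
  gradZero k v (chartAt (EuclideanHalfSpace n) p) (extChartAt (𝓡∂ n) p p) = 0

variable [IsManifold (𝓡∂ n) ((m : ℕ∞ω) + 1) M]

lemma differentiableWithinAt_comp_extend_symm (hm : 1 ≤ m) {v : M → ℝ}
    (hv : ContMDiff (𝓡∂ n) 𝓘(ℝ) m v) {e : OpenPartialHomeomorph M (EuclideanHalfSpace n)}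
    (he : e ∈ IsManifold.maximalAtlas (𝓡∂ n) ((m : ℕ∞ω) + 1) M) {x : EuclideanSpace ℝ (Fin n)}
    (hx : x ∈ (e.extend (𝓡∂ n)).target) :
    DifferentiableWithinAt ℝ (v ∘ (e.extend (𝓡∂ n)).symm) (range (𝓡∂ n)) x :=
  ((contDiffOn_comp_extend_symm hv he x hx).differentiableWithinAt
    (by exact_mod_cast (by omega : m ≠ 0))).mono_of_mem_nhdsWithin (extend_target_mem_nhdsWithin' hx)

lemma partialDeriv_eq_sum (hm : 1 ≤ m) {v : M → ℝ} (hv : ContMDiff (𝓡∂ n) 𝓘(ℝ) m v)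
    {e e' : OpenPartialHomeomorph M (EuclideanHalfSpace n)}
    (he : e ∈ IsManifold.maximalAtlas (𝓡∂ n) ((m : ℕ∞ω) + 1) M)
    (he' : e' ∈ IsManifold.maximalAtlas (𝓡∂ n) ((m : ℕ∞ω) + 1) M)
    {x : EuclideanSpace ℝ (Fin n)} (hx : x ∈ (transition e e').source) (d : Fin n) :
    partialDeriv v e x d =
      ∑ a, jac (transition e e') x a d * partialDeriv v e' (transition e e' x) a := by
  have hφ : HasFDerivWithinAt (transition e e')
      (fderivWithin ℝ (transition e e') (range (𝓡∂ n)) x) (range (𝓡∂ n)) x :=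
    ((contDiffWithinAt_transition he he' hx).differentiableWithinAt
      (by simp)).hasFDerivWithinAt
  have hx' : transition e e' x ∈ (e'.extend (𝓡∂ n)).target := ((transition e e').map_source hx).1
  have h1 := (differentiableWithinAt_comp_extend_symm hm hv he' hx').hasFDerivWithinAt.comp x hφ
    (fun y _ => mem_range_self _)
  have hev : v ∘ (e.extend (𝓡∂ n)).symm =ᶠ[𝓝[range (𝓡∂ n)] x]
      (v ∘ (e'.extend (𝓡∂ n)).symm) ∘ transition e e' := by
    filter_upwards [(𝓡∂ n).extendCoordChange_source_mem_nhdsWithin hx] with y hy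
    exact congrArg v ((e'.extend (𝓡∂ n)).left_inv hy.2).symm
  have h2 := (h1.congr_of_eventuallyEq hev
    (congrArg v ((e'.extend (𝓡∂ n)).left_inv hx.2).symm)).fderivWithin
      ((𝓡∂ n).uniqueDiffOn x (e.extend_target_subset_range hx.1))
  rw [partialDeriv, h2, ContinuousLinearMap.comp_apply]
  conv_lhs => rw [eq_sum_single (fderivWithin ℝ (transition e e') _ _ _)]
  simp only [map_sum, map_smul, smul_eq_mul]
  rfl

/-- The Neumann condition may be checked in any chart. -/
lemma isNeumannAt_of_gradZero (hm : 1 ≤ m) (g : Metric n m M) {v : M → ℝ}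
    (hv : ContMDiff (𝓡∂ n) 𝓘(ℝ) m v)
    {e : OpenPartialHomeomorph M (EuclideanHalfSpace n)}
    (he : e ∈ IsManifold.maximalAtlas (𝓡∂ n) ((m : ℕ∞ω) + 1) M) {p : M}
    (hp : p ∈ (𝓡∂ n).boundary M) (hpe : p ∈ e.source)
    (h : gradZero g.inner v e (e.extend (𝓡∂ n) p) = 0) : IsNeumannAt g.inner v p := by
  set e' := chartAt (EuclideanHalfSpace n) p with he'_def
  have he' : e' ∈ IsManifold.maximalAtlas (𝓡∂ n) ((m : ℕ∞ω) + 1) M :=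
    IsManifold.chart_mem_maximalAtlas p
  have hps : p ∈ e'.source := mem_chart_source _ p
  have hx := extend_mem_transition_source (n := n) hps hpe
  have h0 : e'.extend (𝓡∂ n) p 0 = 0 := (mem_boundary_iff (mem_maximalAtlas_one he') hps).1 hp
  change gradZero g.inner v e' (e'.extend (𝓡∂ n) p) = 0
  have hpos := posDef_jetGram g (mem_maximalAtlas_one he') hx.1
  rw [jet_eq_jetPullback he' he hm g hx] at hpos
  have hkey := sum_inv_jetGram_mul_eq_zero (w := jet g.inner e (transition e' e
    (e'.extend (𝓡∂ n) p))) (Q := hess (transition e' e) (e'.extend (𝓡∂ n) p))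
    (fun i hi => jac_transition_zero he' he hx h0 hi) hpos
    (β := partialDeriv v e (transition e' e (e'.extend (𝓡∂ n) p)))
    (by rw [transition_extend hps]; exact h)
  rw [← jet_eq_jetPullback he' he hm g hx] at hkey
  rw [gradZero, ← hkey]
  exact Finset.sum_congr rfl fun d _ => by rw [partialDeriv_eq_sum hm hv he' he hx]

lemma isNeumannAt_of_eventuallyEq_zero (g : Metric n m M) {v : M → ℝ} {p : M}
    (h : v =ᶠ[𝓝 p] fun _ => 0) : IsNeumannAt g.inner v p := by
  set e := chartAt (EuclideanHalfSpace n) p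
  have hps : p ∈ e.source := mem_chart_source _ p
  have hl : (e.extend (𝓡∂ n)).symm (e.extend (𝓡∂ n) p) = p := e.extend_left_inv hps
  have hc : ContinuousAt (e.extend (𝓡∂ n)).symm (e.extend (𝓡∂ n) p) :=
    e.continuousAt_extend_symm hps
  have hev : v ∘ (e.extend (𝓡∂ n)).symm =ᶠ[𝓝 (e.extend (𝓡∂ n) p)] fun _ => 0 := by
    have h' : v =ᶠ[𝓝 ((e.extend (𝓡∂ n)).symm (e.extend (𝓡∂ n) p))] fun _ => 0 := by rwa [hl]
    exact hc.eventually h'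
  refine Finset.sum_eq_zero fun d _ => ?_
  have h1 : partialDeriv v e (e.extend (𝓡∂ n) p) d = 0 := by
    rw [partialDeriv, (hev.filter_mono nhdsWithin_le_nhds).fderivWithin_eq hev.eq_of_nhds]
    simp
  exact mul_eq_zero_of_right _ h1

lemma IsNeumannAt.sum_mul (hm : 1 ≤ m) (g : Metric n m M) {ι : Type*} [Fintype ι]
    {u : ι → M → ℝ} (hu : ∀ i, ContMDiff (𝓡∂ n) 𝓘(ℝ) m (u i)) (a : ι → ℝ) {p : M}
    (h : ∀ i, IsNeumannAt g.inner (u i) p) :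
    IsNeumannAt g.inner (fun q => ∑ i, a i * u i q) p := by
  set e := chartAt (EuclideanHalfSpace n) p with he_def
  have he : e ∈ IsManifold.maximalAtlas (𝓡∂ n) ((m : ℕ∞ω) + 1) M :=
    IsManifold.chart_mem_maximalAtlas p
  have hps : p ∈ e.source := mem_chart_source _ p
  have hx : e.extend (𝓡∂ n) p ∈ (e.extend (𝓡∂ n)).target :=
    (e.extend (𝓡∂ n)).map_source (by simpa using hps)
  set x := e.extend (𝓡∂ n) p
  have hD := HasFDerivWithinAt.fun_sum (u := Finset.univ) fun i _ =>
    (differentiableWithinAt_comp_extend_symm hm (hu i) he hx).hasFDerivWithinAt.const_mul (a i)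
  have h1 : ∀ d, partialDeriv (fun q => ∑ i, a i * u i q) e x d =
      ∑ i, a i * partialDeriv (u i) e x d := by
    intro d
    have := hD.fderivWithin ((𝓡∂ n).uniqueDiffOn x (e.extend_target_subset_range hx))
    change fderivWithin ℝ (fun y => ∑ i, a i * (u i ∘ (e.extend (𝓡∂ n)).symm) y)
      (range (𝓡∂ n)) x _ = _
    rw [this]
    simp only [sum_apply, smul_apply, smul_eq_mul]
    rfl
  change ∑ d, (jetGram (jet g.inner e x))⁻¹ 0 d * partialDeriv _ e x d = 0
  simp only [h1, Finset.mul_sum]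
  rw [Finset.sum_comm]
  refine Finset.sum_eq_zero fun i _ => ?_
  have h2 : ∑ d, (jetGram (jet g.inner e x))⁻¹ 0 d * partialDeriv (u i) e x d = 0 := h i
  calc _ = a i * ∑ d, (jetGram (jet g.inner e x))⁻¹ 0 d * partialDeriv (u i) e x d := by
        rw [Finset.mul_sum]
        exact Finset.sum_congr rfl fun d _ => by ring
    _ = 0 := by rw [h2, mul_zero]

variable {v : M → ℝ} (hv : ContMDiff (𝓡∂ n) 𝓘(ℝ) m v)

lemma jet_conformal (hm : 1 ≤ m) (g : Metric n m M)
    {e : OpenPartialHomeomorph M (EuclideanHalfSpace n)}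
    (he : e ∈ IsManifold.maximalAtlas (𝓡∂ n) ((m : ℕ∞ω) + 1) M) {x : EuclideanSpace ℝ (Fin n)}
    (hx : x ∈ (e.extend (𝓡∂ n)).target) :
    jet (conformal g v hv).inner e x =
      jetScale (Real.exp (-v ((e.extend (𝓡∂ n)).symm x)))
        (fun d => -Real.exp (-v ((e.extend (𝓡∂ n)).symm x)) * partialDeriv v e x d)
        (jet g.inner e x) := by
  refine Prod.ext rfl ?_
  ext c i j
  have h1 := (differentiableWithinAt_comp_extend_symm hm hv he hx).hasFDerivWithinAt.fun_neg.exp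
  have h2 : HasFDerivWithinAt (comp g.inner e i j)
      (fderivWithin ℝ (comp g.inner e i j) (range (𝓡∂ n)) x) (range (𝓡∂ n)) x :=
    ((contDiffWithinAt_comp he g i j hx).differentiableWithinAt
      (by exact_mod_cast (by omega : m ≠ 0))).hasFDerivWithinAt
  have h3 := (h1.mul h2).fderivWithin
    ((𝓡∂ n).uniqueDiffOn x (e.extend_target_subset_range hx))
  change fderivWithin ℝ (fun y => Real.exp (-(v ∘ (e.extend (𝓡∂ n)).symm) y) *
    comp g.inner e i j y) (range (𝓡∂ n)) x (EuclideanSpace.single c (1 : ℝ)) = _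
  rw [show fderivWithin ℝ (fun y => Real.exp (-(v ∘ (e.extend (𝓡∂ n)).symm) y) *
    comp g.inner e i j y) (range (𝓡∂ n)) x = _ from h3]
  simp only [add_apply, smul_apply, smul_eq_mul, jetScale, jet, neg_apply, partialDeriv,
    Function.comp_apply]
  ring

lemma sum_inv_jetGram_mul_conformal (g : Metric n m M) {p : M} (h : IsNeumannAt g.inner v p)
    (c : ℝ) :
    ∑ d, (jetGram (jet g.inner (chartAt (EuclideanHalfSpace n) p) (extChartAt (𝓡∂ n) p p)))⁻¹ 0 d *
      (c * partialDeriv v (chartAt (EuclideanHalfSpace n) p) (extChartAt (𝓡∂ n) p p) d) = 0 := by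
  simp only [mul_left_comm _ c]
  rw [← Finset.mul_sum]
  exact mul_eq_zero_of_right _ h

section

variable (hm : 1 ≤ m) (g : Metric n m M) {p : M} (h : IsNeumannAt g.inner v p)
include hm h

lemma sff_conformal_ne_zero (h0 : sff g.inner p ≠ 0) : sff (conformal g v hv).inner p ≠ 0 := by
  have he := IsManifold.chart_mem_maximalAtlas (I := 𝓡∂ n) (n := (m : ℕ∞ω) + 1) p
  have hx := mem_extChartAt_target (I := 𝓡∂ n) p
  rw [sff_eq_jetSff, jet_conformal hv hm g he hx,
    jetSff_jetScale (Real.exp_pos _) (posDef_jetGram g (mem_maximalAtlas_one he) hx)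
      (sum_inv_jetGram_mul_conformal g h _)]
  exact smul_ne_zero (Real.sqrt_ne_zero'.2 (Real.exp_pos _)) h0

lemma meanCurv_conformal (h0 : meanCurv g.inner p = 0) :
    meanCurv (conformal g v hv).inner p = 0 := by
  have he := IsManifold.chart_mem_maximalAtlas (I := 𝓡∂ n) (n := (m : ℕ∞ω) + 1) p
  have hx := mem_extChartAt_target (I := 𝓡∂ n) p
  rw [meanCurv_eq_jetMean, jet_conformal hv hm g he hx]
  exact jetMean_jetScale (Real.exp_pos _) (posDef_jetGram g (mem_maximalAtlas_one he) hx)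
      (sum_inv_jetGram_mul_conformal g h _) h0

lemma sffNormSq_conformal :
    sffNormSq (conformal g v hv).inner p = Real.exp (v p) * sffNormSq g.inner p := by
  have he := IsManifold.chart_mem_maximalAtlas (I := 𝓡∂ n) (n := (m : ℕ∞ω) + 1) p
  have hx := mem_extChartAt_target (I := 𝓡∂ n) p
  have hl : ((chartAt (EuclideanHalfSpace n) p).extend (𝓡∂ n)).symm (extChartAt (𝓡∂ n) p p) = p :=
    extChartAt_to_inv p
  rw [sffNormSq_eq_jetNormSq, jet_conformal hv hm g he hx,
    jetNormSq_jetScale (Real.exp_pos _) (posDef_jetGram g (mem_maximalAtlas_one he) hx)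
      (sum_inv_jetGram_mul_conformal g h _), hl, ← Real.exp_neg, neg_neg]
  rfl

end

lemma chartFun_pos (hm : 1 ≤ m) {g : Metric n m M} (hg : g ∈ nowhereVanishing n m M)
    {e : OpenPartialHomeomorph M (EuclideanHalfSpace n)}
    (he : e ∈ IsManifold.maximalAtlas (𝓡∂ n) ((m : ℕ∞ω) + 1) M) {y : EuclideanSpace ℝ (TIdx n)}
    (hy : inclBdry y ∈ (e.extend (𝓡∂ n)).target) : 0 < chartFun g.inner e y := by
  obtain ⟨hb, h⟩ := chartFun_eq_sffNormSq hm g he hy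
  rw [h, sffNormSq_eq_jetNormSq]
  exact jetNormSq_pos (posDef_jetGram g (IsManifold.chart_mem_maximalAtlas _)
    (mem_extChartAt_target _)) (hg _ hb)

end NormalDerivative

/-! ### Perturbations by functions with vanishing normal derivative -/

section Perturbation

variable {n : ℕ} [NeZero n] {M : Type*} [TopologicalSpace M]
  [ChartedSpace (EuclideanHalfSpace n) M] [IsManifold (𝓡∂ n) 1 M] {m : ℕ}
  [IsManifold (𝓡∂ n) ((m : ℕ∞ω) + 1) M]

lemma contDiffOn_inv_jetGram (g : Metric n m M)
    {e : OpenPartialHomeomorph M (EuclideanHalfSpace n)}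
    (he : e ∈ IsManifold.maximalAtlas (𝓡∂ n) ((m : ℕ∞ω) + 1) M) (i j : Fin n) :
    ContDiffOn ℝ m (fun x => (jetGram (jet g.inner e x))⁻¹ i j) (e.extend (𝓡∂ n)).target := by
  intro x hx
  have h1 : ContDiffWithinAt ℝ m (fun x => fun i j => comp g.inner e i j x)
      (e.extend (𝓡∂ n)).target x :=
    contDiffWithinAt_pi.2 fun i => contDiffWithinAt_pi.2 fun j => contDiffOn_comp he g i j x hx
  exact (contDiffAt_inv_apply (A := fun i j => comp g.inner e i j x)
    (posDef_jetGram g (mem_maximalAtlas_one he) hx).det_pos.ne' i j).comp_contDiffWithinAt x h1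

/-- The correction `w - x₀ (∑ g^{0d} ∂_d w) / g^{00}` of a function `w` of the coordinates: it agrees
with `w` on the boundary, and its normal derivative vanishes there. -/
def neumannCorrection (k : TensorField n M) (e : OpenPartialHomeomorph M (EuclideanHalfSpace n))
    (w : EuclideanSpace ℝ (Fin n) → ℝ) (x : EuclideanSpace ℝ (Fin n)) : ℝ :=
  w x - x 0 * ((∑ d, (jetGram (jet k e x))⁻¹ 0 d * fderiv ℝ w x (EuclideanSpace.single d (1 : ℝ))) /
    (jetGram (jet k e x))⁻¹ 0 0)

variable {w : EuclideanSpace ℝ (Fin n) → ℝ}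

lemma contDiffOn_neumannCoeff (hw : ContDiff ℝ ∞ w) (g : Metric n m M)
    {e : OpenPartialHomeomorph M (EuclideanHalfSpace n)}
    (he : e ∈ IsManifold.maximalAtlas (𝓡∂ n) ((m : ℕ∞ω) + 1) M) :
    ContDiffOn ℝ m (fun x => (∑ d, (jetGram (jet g.inner e x))⁻¹ 0 d *
      fderiv ℝ w x (EuclideanSpace.single d (1 : ℝ))) / (jetGram (jet g.inner e x))⁻¹ 0 0)
      (e.extend (𝓡∂ n)).target := by
  refine ContDiffOn.div ?_ (contDiffOn_inv_jetGram g he 0 0) fun x hx =>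
    (posDef_jetGram g (mem_maximalAtlas_one he) hx).inv.diag_pos.ne'
  have hD : ∀ d : Fin n, ContDiff ℝ m fun x => fderiv ℝ w x (EuclideanSpace.single d (1 : ℝ)) :=
    fun d => ((hw.of_le (m := (m : ℕ∞ω) + 1) (by exact_mod_cast le_top)).fderiv_right
      le_rfl).clm_apply contDiff_const
  exact ContDiffOn.sum fun d _ => (contDiffOn_inv_jetGram g he 0 d).mul (hD d).contDiffOn

lemma contDiffOn_neumannCorrection (hw : ContDiff ℝ ∞ w) (g : Metric n m M)
    {e : OpenPartialHomeomorph M (EuclideanHalfSpace n)}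
    (he : e ∈ IsManifold.maximalAtlas (𝓡∂ n) ((m : ℕ∞ω) + 1) M) :
    ContDiffOn ℝ m (neumannCorrection g.inner e w) (e.extend (𝓡∂ n)).target := by
  have h0 : ContDiff ℝ m fun x : EuclideanSpace ℝ (Fin n) => x 0 := by fun_prop
  exact (hw.of_le (by exact_mod_cast le_top)).contDiffOn.sub
    (h0.contDiffOn.mul (contDiffOn_neumannCoeff hw g he))

lemma neumannCorrection_of_notMem_tsupport (k : TensorField n M)
    (e : OpenPartialHomeomorph M (EuclideanHalfSpace n)) {x : EuclideanSpace ℝ (Fin n)}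
    (hx : x ∉ tsupport w) : neumannCorrection k e w x = 0 := by
  have h1 : fderiv ℝ w x = 0 := by
    by_contra h
    exact hx (support_fderiv_subset ℝ h)
  rw [neumannCorrection, image_eq_zero_of_notMem_tsupport hx, h1]
  simp

lemma sum_inv_jetGram_mul_fderivWithin_neumannCorrection (hm : 1 ≤ m) (hw : ContDiff ℝ ∞ w)
    (g : Metric n m M) {e : OpenPartialHomeomorph M (EuclideanHalfSpace n)}
    (he : e ∈ IsManifold.maximalAtlas (𝓡∂ n) ((m : ℕ∞ω) + 1) M) {x : EuclideanSpace ℝ (Fin n)}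
    (hx : x ∈ (e.extend (𝓡∂ n)).target) (h0 : x 0 = 0) :
    ∑ d, (jetGram (jet g.inner e x))⁻¹ 0 d *
      fderivWithin ℝ (neumannCorrection g.inner e w) (range (𝓡∂ n)) x
        (EuclideanSpace.single d (1 : ℝ)) = 0 := by
  have hG : (jetGram (jet g.inner e x))⁻¹ 0 0 ≠ 0 :=
    (posDef_jetGram g (mem_maximalAtlas_one he) hx).inv.diag_pos.ne'
  have h1 := (((contDiffOn_neumannCoeff hw g he x hx).differentiableWithinAt
    (by exact_mod_cast (by omega : m ≠ 0))).mono_of_mem_nhdsWithin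
      (extend_target_mem_nhdsWithin' hx)).hasFDerivWithinAt
  have h2 : HasFDerivWithinAt (fun x : EuclideanSpace ℝ (Fin n) => x 0)
      (EuclideanSpace.proj 0 : EuclideanSpace ℝ (Fin n) →L[ℝ] ℝ) (range (𝓡∂ n)) x :=
    (EuclideanSpace.proj 0 : EuclideanSpace ℝ (Fin n) →L[ℝ] ℝ).hasFDerivWithinAt
  have h3 : HasFDerivWithinAt w (fderiv ℝ w x) (range (𝓡∂ n)) x :=
    (hw.differentiable (by simp) x).hasFDerivAt.hasFDerivWithinAt
  have h4 := (h3.sub (h2.mul h1)).fderivWithin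
    ((𝓡∂ n).uniqueDiffOn x (e.extend_target_subset_range hx))
  have h5 : ∀ d, fderivWithin ℝ (neumannCorrection g.inner e w) (range (𝓡∂ n)) x
      (EuclideanSpace.single d (1 : ℝ)) = fderiv ℝ w x (EuclideanSpace.single d (1 : ℝ)) -
      ((∑ d, (jetGram (jet g.inner e x))⁻¹ 0 d * fderiv ℝ w x (EuclideanSpace.single d (1 : ℝ))) /
        (jetGram (jet g.inner e x))⁻¹ 0 0) * (if d = 0 then 1 else 0) := by
    intro d
    rw [show fderivWithin ℝ (neumannCorrection g.inner e w) (range (𝓡∂ n)) x = _ from h4]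
    simp [h0, eq_comm]
  simp only [h5, mul_sub, Finset.sum_sub_distrib]
  simp only [mul_ite, mul_one, mul_zero, Finset.sum_ite_eq', Finset.mem_univ, if_true]
  rw [mul_div_cancel₀ _ hG, sub_self]

/-- A compactly supported function of the coordinates can be realised on the boundary by a function
on `M` whose normal derivative vanishes. -/
lemma exists_isNeumannAt [T2Space M] (hm : 1 ≤ m) (g : Metric n m M)
    {e : OpenPartialHomeomorph M (EuclideanHalfSpace n)}
    (he : e ∈ IsManifold.maximalAtlas (𝓡∂ n) ((m : ℕ∞ω) + 1) M)
    (hw : ContDiff ℝ ∞ w) (hc : HasCompactSupport w)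
    (hs : tsupport w ∩ range (𝓡∂ n) ⊆ (e.extend (𝓡∂ n)).target) :
    ∃ u : M → ℝ, ContMDiff (𝓡∂ n) 𝓘(ℝ) m u ∧
      (∀ p ∈ (𝓡∂ n).boundary M, IsNeumannAt g.inner u p) ∧
      ∀ y, inclBdry y ∈ (e.extend (𝓡∂ n)).target →
        u ((e.extend (𝓡∂ n)).symm (inclBdry y)) = w (inclBdry y) := by
  classical
  let U := neumannCorrection g.inner e w
  let u : M → ℝ := e.source.indicator (U ∘ e.extend (𝓡∂ n))
  let S : Set M := (e.extend (𝓡∂ n)).symm '' (tsupport w ∩ range (𝓡∂ n))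
  have hSclosed : IsClosed S :=
    ((hc.isCompact.inter_right (𝓡∂ n).isClosed_range).image_of_continuousOn
      ((e.continuousOn_extend_symm).mono hs)).isClosed
  have hSsource : S ⊆ e.source := by
    rintro _ ⟨x, hx, rfl⟩
    simpa using (e.extend (𝓡∂ n)).map_target (hs hx)
  have hu0 : ∀ p ∉ S, u p = 0 := by
    intro p hp
    by_cases hpe : p ∈ e.source
    · rw [show u p = U (e.extend (𝓡∂ n) p) from indicator_of_mem hpe _]
      refine neumannCorrection_of_notMem_tsupport _ _ fun h => hp ?_
      exact ⟨_, ⟨h, mem_range_self _⟩, e.extend_left_inv hpe⟩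
    · exact indicator_of_notMem hpe _
  have hev0 : ∀ p ∉ S, u =ᶠ[𝓝 p] fun _ => 0 := fun p hp => by
    filter_upwards [hSclosed.isOpen_compl.mem_nhds hp] with q hq using hu0 q hq
  have huU : ∀ x ∈ (e.extend (𝓡∂ n)).target, u ((e.extend (𝓡∂ n)).symm x) = U x := by
    intro x hx
    have hq : (e.extend (𝓡∂ n)).symm x ∈ e.source := by
      simpa using (e.extend (𝓡∂ n)).map_target hx
    rw [show u _ = U (e.extend (𝓡∂ n) _) from indicator_of_mem hq _,
      (e.extend (𝓡∂ n)).right_inv hx]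
  have hu : ContMDiff (𝓡∂ n) 𝓘(ℝ) m u := by
    intro p
    by_cases hp : p ∈ S
    · have hpe := hSsource hp
      have h1 : ContMDiffOn (𝓡∂ n) 𝓘(ℝ) m (U ∘ e.extend (𝓡∂ n)) e.source :=
        (contDiffOn_neumannCorrection hw g he).contMDiffOn.comp
          (fun q hq => (e.contMDiffAt_extend (IsManifold.maximalAtlas_subset_of_le
            (le_self_add (b := 1)) he) hq).contMDiffWithinAt)
          fun q hq => (e.extend (𝓡∂ n)).map_source (by simpa using hq)
      refine (h1.contMDiffAt (e.open_source.mem_nhds hpe)).congr_of_eventuallyEq ?_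
      filter_upwards [e.open_source.mem_nhds hpe] with q hq using indicator_of_mem hq _
    · exact contMDiffAt_const.congr_of_eventuallyEq (hev0 p hp)
  refine ⟨u, hu, fun p hp => ?_, fun y hy => ?_⟩
  · -- In the chart `e` the condition holds by construction; elsewhere `u` vanishes locally.
    by_cases hpS : p ∈ S
    · have hpe := hSsource hpS
      refine isNeumannAt_of_gradZero hm g hu he hp hpe ?_
      have hx : e.extend (𝓡∂ n) p ∈ (e.extend (𝓡∂ n)).target :=
        (e.extend (𝓡∂ n)).map_source (by simpa using hpe)
      rw [← sum_inv_jetGram_mul_fderivWithin_neumannCorrection hm hw g he hx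
        ((mem_boundary_iff (mem_maximalAtlas_one he) hpe).1 hp), gradZero]
      refine Finset.sum_congr rfl fun d _ => ?_
      rw [partialDeriv, Filter.EventuallyEq.fderivWithin_eq (f₁ := u ∘ _)
        (f := neumannCorrection g.inner e w) ?_ (huU _ hx)]
      filter_upwards [extend_target_mem_nhdsWithin' hx] with z hz using huU z hz
    · exact isNeumannAt_of_eventuallyEq_zero g (hev0 p hpS)
  · rw [huU _ hy]
    simp [U, neumannCorrection]

/-- Density near a point: if a half-ball of radius `3r` around `x₀` lies in the domain of the
coordinates `e`, then conformal changes of `g` that are arbitrarily small in the `C^m` norm achieve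
the Morse condition on the concentric half-ball of radius `2r`. -/
lemma exists_conformal_nondegAtPoint [T2Space M] [CompactSpace M] (hm : 3 ≤ m)
    (C : ChartCover n m M) {e : OpenPartialHomeomorph M (EuclideanHalfSpace n)}
    (he : e ∈ IsManifold.maximalAtlas (𝓡∂ n) ((m : ℕ∞ω) + 1) M)
    {x₀ : EuclideanSpace ℝ (Fin n)} {r : ℝ} (hr : 0 < r)
    (hball : Metric.closedBall x₀ (3 * r) ∩ range (𝓡∂ n) ⊆ (e.extend (𝓡∂ n)).target)
    {g : Metric n m M} (hg : g ∈ nowhereVanishing n m M ∩ minimalBoundary n m M)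
    {ε : ℝ≥0∞} (hε : 0 < ε) :
    ∃ g' ∈ nowhereVanishing n m M ∩ minimalBoundary n m M,
      cmNorm C (fun p => g'.inner p - g.inner p) < ε ∧
      ∀ p ∈ e.source, e.extend (𝓡∂ n) p ∈ Metric.ball x₀ (2 * r) → p ∈ (𝓡∂ n).boundary M →
        NondegAtPoint g' p := by
  have hm1 : 1 ≤ m := by omega
  let χ : ContDiffBump x₀ := ⟨2 * r, 3 * r, by linarith, by linarith⟩
  let w : TIdx n → EuclideanSpace ℝ (Fin n) → ℝ := fun i x => χ x * x i.1
  have hts : ∀ i, tsupport (w i) ⊆ Metric.closedBall x₀ (3 * r) := fun i =>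
    (tsupport_mul_subset_left (f := χ) (g := fun x => x i.1)).trans χ.tsupport_eq.subset
  choose u hu huN huw using fun i => exists_isNeumannAt (w := w i) hm1 g he
    (χ.contDiff.mul (by fun_prop)) (χ.hasCompactSupport.mul_right)
    ((inter_subset_inter_left _ (hts i)).trans hball)
  -- On the boundary `log ‖sff‖²` is of class `C^2`, and replacing `g` by `exp(-∑ aᵢ uᵢ) g` adds to it the
  -- linear function `⟨a, ·⟩` wherever the cutoff `χ` equals one.
  let φ : EuclideanSpace ℝ (TIdx n) → ℝ := fun y => Real.log (chartFun g.inner e y)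
  have hφ : ∀ y ∈ {y | inclBdry y ∈ (e.extend (𝓡∂ n)).target}, ContDiffAt ℝ 2 φ y := fun y hy =>
    (contDiffAt_chartFun he hm g hy).log (chartFun_pos hm1 hg.1 he hy).ne'
  have hae := ae_nondegAt_add_linear hφ
  have hsmall := (tendsto_cmNorm_conformal C g hu).eventually (gt_mem_nhds hε)
  obtain ⟨a, ha, haε⟩ : ∃ a : EuclideanSpace ℝ (TIdx n),
      (∀ y ∈ {y | inclBdry y ∈ (e.extend (𝓡∂ n)).target},
        NondegAt (fun z => φ z + inner ℝ a z) y) ∧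
      cmNorm C (fun p => (conformal g (fun p => ∑ i, a i * u i p)
        (contMDiff_sum_smul hu a)).inner p - g.inner p) < ε := by
    -- A null set contains no neighbourhood of zero.
    by_contra! hcon
    have h0 : volume {a : EuclideanSpace ℝ (TIdx n) | ¬ ∀ y ∈ {y | inclBdry y ∈
        (e.extend (𝓡∂ n)).target}, NondegAt (fun z => φ z + inner ℝ a z) y} = 0 := hae
    refine (Measure.measure_pos_of_mem_nhds volume hsmall).ne' (measure_mono_null ?_ h0)
    intro a ha1 ha2
    exact (hcon a ha2).not_gt ha1
  have hv := contMDiff_sum_smul hu a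
  have hN : ∀ p ∈ (𝓡∂ n).boundary M, IsNeumannAt g.inner (fun p => ∑ i, a i * u i p) p :=
    fun p hp => IsNeumannAt.sum_mul hm1 g hu a fun i => huN i p hp
  refine ⟨conformal g _ hv, ⟨fun p hp => sff_conformal_ne_zero hv hm1 g (hN p hp) (hg.1 p hp),
    fun p hp => meanCurv_conformal hv hm1 g (hN p hp) (hg.2 p hp)⟩, haε, fun p hpe hpx hpb => ?_⟩
  rw [nondegAtPoint_iff hm _ he hpb hpe]
  have hiy := inclBdry_tangPart ((mem_boundary_iff (mem_maximalAtlas_one he) hpe).1 hpb)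
  set y := tangPart (e.extend (𝓡∂ n) p)
  have hy : inclBdry y ∈ (e.extend (𝓡∂ n)).target := by
    rw [hiy]
    exact (e.extend (𝓡∂ n)).map_source (by simpa using hpe)
  have hd := ha y hy
  refine NondegAt.congr (hd.exp ((hφ y hy).add ?_)) ?_
  · exact (innerSL ℝ a).contDiff.contDiffAt
  · have hb : ∀ᶠ z in 𝓝 y, inclBdry z ∈ Metric.ball x₀ (2 * r) :=
      continuous_inclBdry.continuousAt.eventually (Metric.isOpen_ball.mem_nhds (by rwa [hiy]))
    filter_upwards [hb, (tendsto_inclBdry y).eventually (extend_target_mem_nhdsWithin' hy)]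
      with z hz hzT
    obtain ⟨hzb, hz1⟩ := chartFun_eq_sffNormSq hm1 (conformal g _ hv) he hzT
    rw [hz1, sffNormSq_conformal hv hm1 g (hN _ hzb), ← (chartFun_eq_sffNormSq hm1 g he hzT).2,
      Real.exp_add, Real.exp_log (chartFun_pos hm1 hg.1 he hzT), mul_comm]
    congr 2
    rw [PiLp.inner_apply]
    refine Finset.sum_congr rfl fun i _ => ?_
    have hχ : χ (inclBdry z) = 1 := χ.one_of_mem_closedBall (Metric.ball_subset_closedBall hz)
    have hzi : inclBdry z i.1 = z i := by simp [inclBdry, i.2]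
    rw [huw i z hzT]
    simp only [w, hχ, hzi, one_mul]
    simp [mul_comm]

/-- The neighbourhood `K` has to be the same for all metrics `g`, for a finite subcover to serve
all of them. -/
lemma exists_compact_nhds_approx [T2Space M] [CompactSpace M] (hm : 3 ≤ m)
    (C : ChartCover n m M) (p₀ : M) :
    ∃ K ∈ 𝓝 p₀, IsCompact K ∧ ∀ g ∈ nowhereVanishing n m M ∩ minimalBoundary n m M,
      ∀ ε : ℝ≥0∞, 0 < ε → ∃ g' ∈ nowhereVanishing n m M ∩ minimalBoundary n m M,
        cmNorm C (fun p => g'.inner p - g.inner p) < ε ∧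
        ∀ p ∈ K, p ∈ (𝓡∂ n).boundary M → NondegAtPoint g' p := by
  set e := chartAt (EuclideanHalfSpace n) p₀
  have he : e ∈ IsManifold.maximalAtlas (𝓡∂ n) ((m : ℕ∞ω) + 1) M :=
    IsManifold.chart_mem_maximalAtlas p₀
  have hps : p₀ ∈ e.source := mem_chart_source _ p₀
  obtain ⟨R, hR, hRT⟩ := Metric.mem_nhdsWithin_iff.1
    (e.extend_target_mem_nhdsWithin (I := 𝓡∂ n) hps)
  set x₀ := e.extend (𝓡∂ n) p₀
  have hball : Metric.closedBall x₀ (3 * (R / 4)) ∩ range (𝓡∂ n) ⊆ (e.extend (𝓡∂ n)).target :=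
    (inter_subset_inter_left _ (Metric.closedBall_subset_ball (by linarith))).trans hRT
  have hU : e.source ∩ e.extend (𝓡∂ n) ⁻¹' Metric.ball x₀ (2 * (R / 4)) ∈ 𝓝 p₀ :=
    inter_mem (e.open_source.mem_nhds hps)
      ((e.continuousAt_extend hps).preimage_mem_nhds (Metric.ball_mem_nhds _ (by positivity)))
  obtain ⟨K, hK, hKU, hKc⟩ := local_compact_nhds hU
  refine ⟨K, hK, hKc, fun g hg ε hε => ?_⟩
  obtain ⟨g', hg', h1, h2⟩ := exists_conformal_nondegAtPoint hm C he (r := R / 4) (by positivity)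
    hball hg hε
  exact ⟨g', hg', h1, fun p hp => h2 p (hKU hp).1 (hKU hp).2⟩

end Perturbation

/-! ### Density -/

section Density

variable {n : ℕ} [NeZero n] {M : Type*} [TopologicalSpace M] [T2Space M] [CompactSpace M]
  [ChartedSpace (EuclideanHalfSpace n) M] [IsManifold (𝓡∂ n) 1 M] {m : ℕ}
  [IsManifold (𝓡∂ n) ((m : ℕ∞ω) + 1) M]

/-- The compact sets over which the Morse condition is imposed are glued: openness is needed for
finite intersections of the dense sets to be dense. -/
lemma isOpen_and_dense_nondegenerate (hm : 3 ≤ m) (C : ChartCover n m M) :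
    letI : TopologicalSpace (Metric n m M) := cmTopology C
    let N : Set (Metric n m M) := nowhereVanishing n m M ∩ minimalBoundary n m M
    IsOpen {g : N | (g : Metric n m M) ∈ nondegenerate n m M} ∧
      Dense {g : N | (g : Metric n m M) ∈ nondegenerate n m M} := by
  let _ : TopologicalSpace (Metric n m M) := cmTopology C
  intro N
  let Nd : Set M → Set N := fun K => {g | ∀ p ∈ K, p ∈ (𝓡∂ n).boundary M →
    NondegAtPoint (g : Metric n m M) p}
  have hopen : ∀ K, IsCompact K → IsOpen (Nd K) := fun K hK =>
    (isOpen_nondegAtPoint_of_isCompact hm C hK).preimage continuous_subtype_val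
  have huniv : {g : N | (g : Metric n m M) ∈ nondegenerate n m M} = Nd univ := by
    ext g
    refine (mem_nondegenerate_iff (by omega) (g : Metric n m M)).trans ?_
    exact ⟨fun h p _ => h p, fun h p => h p (mem_univ p)⟩
  rw [huniv]
  refine ⟨hopen _ isCompact_univ, ?_⟩
  choose K hK hKc hKd using exists_compact_nhds_approx (M := M) hm C
  have hdense : ∀ p, Dense (Nd (K p)) := by
    intro p
    rw [dense_iff_inter_open]
    rintro W hW ⟨g, hg⟩
    obtain ⟨W', hW', rfl⟩ := isOpen_induced_iff.1 hW
    obtain ⟨ε, hε, h⟩ := hW' g.1 hg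
    obtain ⟨g', hg'N, hg'ε, hg'd⟩ := hKd p g.1 g.2 ε hε
    exact ⟨⟨g', hg'N⟩, h g' hg'ε, hg'd⟩
  obtain ⟨t, -, ht⟩ := isCompact_univ.elim_nhds_subcover K fun p _ => hK p
  have hfin : Dense (⋂₀ ((fun p => Nd (K p)) '' (t : Set M))) := by
    refine (t.finite_toSet.image _).dense_sInter ?_ ?_
    · rintro _ ⟨p, -, rfl⟩
      exact hopen _ (hKc p)
    · rintro _ ⟨p, -, rfl⟩
      exact hdense p
  refine hfin.mono fun g hg p _ hpb => ?_
  obtain ⟨q, hq, hpq⟩ := mem_iUnion₂.1 (ht (mem_univ p))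
  exact hg _ (mem_image_of_mem _ hq) p hpq hpb

end Density

end BoundaryMorse

end

theorem theorem1 (n : ℕ) [NeZero n] (hn : 3 ≤ n) (m : ℕ) (hm : 3 ≤ m)
    (M : Type*) [TopologicalSpace M] [T2Space M] [CompactSpace M]
    [ChartedSpace (EuclideanHalfSpace n) M]
    [IsManifold (𝓡∂ n) 1 M] [IsManifold (𝓡∂ n) ((m : ℕ∞ω) + 1) M]
    (C : BoundaryMorse.ChartCover n m M) :
    letI : TopologicalSpace (BoundaryMorse.Metric n m M) := BoundaryMorse.cmTopology C
    let N : Set (BoundaryMorse.Metric n m M) :=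
      BoundaryMorse.nowhereVanishing n m M ∩ BoundaryMorse.minimalBoundary n m M
    let A : Set (BoundaryMorse.Metric n m M) :=
      {g | g ∈ N ∧ g ∈ BoundaryMorse.nondegenerate n m M}
    IsOpen {g : N | (g : BoundaryMorse.Metric n m M) ∈ A} ∧
      Dense {g : N | (g : BoundaryMorse.Metric n m M) ∈ A} := by
  let _ : TopologicalSpace (BoundaryMorse.Metric n m M) := BoundaryMorse.cmTopology C
  intro N A
  have hA : {g : N | (g : BoundaryMorse.Metric n m M) ∈ A} =
      {g : N | (g : BoundaryMorse.Metric n m M) ∈ BoundaryMorse.nondegenerate n m M} :=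
    Set.ext fun g => and_iff_right g.2
  rw [hA]
  exact BoundaryMorse.isOpen_and_dense_nondegenerate hm C
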